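/- Let $1<p<\infty$, $p^*=p/(p-1)$, and $\phi_r(s)=|s|^{r-2}s$ for $s\in\mathbb R$. For a real potential $q\in L^p[0,1]$ let $\lambda_1(q)<\lambda_2(q)<\cdots$ be the eigenvalues of $-y''+q(x)y=\lambda y$, $y(0)=y(1)=0$, where solutions are $C^1$ functions on $[0,1]$ with absolutely continuous derivative that satisfy the equation almost everywhere. Let $E_m(\cdot;q)$ be an eigenfunction for $\lambda_m(q)$, and let $T_{1,m}(q)<\cdots<T_{m-1,m}(q)$ be its zeros in $(0,1)$. Fix integers $1\le i<m$, a number $T_*\in(0,1)$ and $q_0\in L^p[0,1]$. Let $\hat q\in L^p[0,1]$ be a solution of Problem $(P)$, i.e. $T_{i,m}(\hat q)=T_*$ and $\|\hat q-q_0\|_{L^p}\le\|q-q_0\|_{L^p}$ for all $q\in L^p[0,1]$ with $T_{i,m}(q)=T_*$, and suppose $\hat q\ne q_0$. Let $\lambda_m=\lambda_m(\hat q)$, let $E=E_m(\cdot;\hat q)$ be an associated eigenfunction, and put $$a=\int_{T_*}^1\Big(\frac{E(v)}{E'(T_*)}\Big)^2dv,\qquad b=\int_0^{T_*}\Big(\frac{E(v)}{E'(T_*)}\Big)^2dv,\qquad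 H=\begin{cases}a&\text{on }[0,T_*],\\-b&\text{on }(T_*,1].\end{cases}$$ Then there is a real number $c\neq0$ such that $$\|\hat q-q_0\|_{L^p}^{1-p}\,\phi_p(\hat q-q_0)=c\,H\,E^2\quad\text{a.e. on }[0,1],$$ and with $\varepsilon=\operatorname{sign}(c)=\pm1$ and the piecewise rescaled eigenfunction $$u_m(x)=\begin{cases}\sqrt{\big|\,\|\hat q-q_0\|_{L^p}^{p-1}\,a\,c\,\big|}\;E(x),&x\in[0,T_*],\\[2pt]\sqrt{\big|\,\|\hat q-q_0\|_{L^p}^{p-1}\,b\,c\,\big|}\;E(x),&x\in(T_*,1],\end{cases}$$ the following hold. 1. On each of the intervals $[0,T_*]$ and $[T_*,1]$ the function $u_m$ is $C^1$ (one-sidedly at end points) with absolutely continuous derivative, and almost everywhere $$-u_m''+q_0u_m+\varepsilon\,\phi_{2p^*}(u_m)=\lambda_mu_m\ \text{ on }[0,T_*],\qquad -u_m''+q_0u_m-\varepsilon\,\phi_{2p^*}(u_m)=\lambda_mu_m\ \text{ on }[T_*,1].$$ 2. $u_m(0)=u_m(T_*)=u_m(1)=0$; $u_m$ has exactly $i-1$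 zeros in $(0,T_*)$ and exactly $m-1-i$ zeros in $(T_*,1)$. 3. $\hat q-q_0=\varepsilon|u_m|^{2p^*-2}$ a.e. on $[0,T_*]$ and $\hat q-q_0=-\varepsilon|u_m|^{2p^*-2}$ a.e. on $(T_*,1]$. -/

import Mathlib

open MeasureTheory Set
open scoped ENNReal

noncomputable section

namespace InverseNodal

/-- The space `L^p([0,1], ℝ)`. -/
abbrev Potential (p : ℝ) : Type :=
  Lp ℝ (ENNReal.ofReal p) (volume.restrict (Icc (0 : ℝ) 1))

/-- The map `φ_r(s) = |s|^(r-2) s`. -/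
def phi (r s : ℝ) : ℝ := |s| ^ (r - 2) * s

/-- The conjugate exponent `p* = p / (p - 1)`. -/
def conjExp (p : ℝ) : ℝ := p / (p - 1)

/-- `u` is differentiable on `[a,b]` (one-sidedly at the end points), `u'` is absolutely continuous
on `[a,b]`, and `u'' = w` almost everywhere on `[a,b]`. -/
def HasSecondDerivOn (a b : ℝ) (u w : ℝ → ℝ) : Prop :=
  ∃ v : ℝ → ℝ,
    (∀ x ∈ Icc a b, HasDerivWithinAt u (v x) (Icc a b) x) ∧
    AbsolutelyContinuousOnInterval v a b ∧
    ∀ᵐ x ∂(volume.restrict (Icc a b)), HasDerivAt v (w x) x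

/-- `E` is a (nontrivial) Dirichlet eigenfunction of `-y'' + q y = lam y` on `[0,1]`. -/
structure IsEigenfunction (q : ℝ → ℝ) (lam : ℝ) (E : ℝ → ℝ) : Prop where
  equation : ∃ w : ℝ → ℝ, HasSecondDerivOn 0 1 E w ∧
    ∀ᵐ x ∂(volume.restrict (Icc (0 : ℝ) 1)), -w x + q x * E x = lam * E x
  left : E 0 = 0
  right : E 1 = 0
  nontrivial : ∃ x ∈ Icc (0 : ℝ) 1, E x ≠ 0

/-- `lam` is a Dirichlet eigenvalue of `-y'' + q y = lam y` on `[0,1]`. -/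
def IsEigenvalue (q : ℝ → ℝ) (lam : ℝ) : Prop :=
  ∃ E : ℝ → ℝ, IsEigenfunction q lam E

/-- `lam = λ_m(q)`, the `m`-th eigenvalue in increasing order, counted from `m = 1`. -/
def IsNthEigenvalue (q : ℝ → ℝ) (m : ℕ) (lam : ℝ) : Prop :=
  IsEigenvalue q lam ∧ {μ : ℝ | IsEigenvalue q μ ∧ μ < lam}.encard + 1 = (m : ℕ∞)

/-- `lam = λ_m(q)` and `E = E_m(·; q)` is an associated eigenfunction. -/
def IsNthEigenpair (q : ℝ → ℝ) (m : ℕ) (lam : ℝ) (E : ℝ → ℝ) : Prop :=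
  IsNthEigenvalue q m lam ∧ IsEigenfunction q lam E

/-- `T = T_{i,m}(q)`: the `i`-th zero in `(0,1)`, in increasing order and counted from `i = 1`, of
the `m`-th eigenfunction. -/
def IsNode (q : ℝ → ℝ) (i m : ℕ) (T : ℝ) : Prop :=
  ∃ (lam : ℝ) (E : ℝ → ℝ), IsNthEigenpair q m lam E ∧
    T ∈ Ioo (0 : ℝ) 1 ∧ E T = 0 ∧ {x ∈ Ioo 0 T | E x = 0}.encard + 1 = (i : ℕ∞)

/-- `qhat` solves Problem (P): it minimizes `‖q - q₀‖_{L^p}` among all `q ∈ L^p` with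
`T_{i,m}(q) = T`. -/
structure IsMinimizer (p : ℝ) (i m : ℕ) (T : ℝ) (q₀ qhat : Potential p) : Prop where
  node : IsNode qhat i m T
  minimal : ∀ q : Potential p, IsNode q i m T → ‖qhat - q₀‖ ≤ ‖q - q₀‖

/-- The constant `a = ∫_T^1 (E(v) / E'(T))² dv`. -/
def coeffA (E : ℝ → ℝ) (T : ℝ) : ℝ := ∫ v in T..1, (E v / deriv E T) ^ 2

/-- The constant `b = ∫_0^T (E(v) / E'(T))² dv`. -/
def coeffB (E : ℝ → ℝ) (T : ℝ) : ℝ := ∫ v in (0 : ℝ)..T, (E v / deriv E T) ^ 2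

/-- The step function `H`, equal to `a` on `[0,T]` and to `-b` on `(T,1]`. -/
def stepH (E : ℝ → ℝ) (T x : ℝ) : ℝ := if x ≤ T then coeffA E T else -coeffB E T

/-- The piecewise rescaled eigenfunction: `√|R^(p-1) a c| E` on `[0,T]` and `√|R^(p-1) b c| E` on
`(T,1]`, where `R` stands for the distance `‖qhat - q₀‖_{L^p}` and `c` for the multiplier. -/
def rescaled (p R c : ℝ) (E : ℝ → ℝ) (T x : ℝ) : ℝ :=
  if x ≤ T then √|R ^ (p - 1) * coeffA E T * c| * E x
  else √|R ^ (p - 1) * coeffB E T * c| * E x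

end InverseNodal

end

/-! The node is never differentiated as a functional on `L^p`, and no abstract multiplier theorem is
used. Explicit curves of admissible potentials through `qhat` are built instead. Let `w` be bounded,
zero wherever `|E| < κ`, and orthogonal to `E²` on `[0,T]` and on `[T,1]` separately. Solve `η'' =
(qhat - lam) η + w E` with zero Cauchy data at `0`; the Wronskian of `η` and `E` then forces `η T =
η 1 = 0`. The function `E + t η` solves the equation with the same `lam` and the potential `qhat + t
w - t² w η / (E + t η)`. Since `w` vanishes near the zeros of `E`, the last term is uniformly
`O(t²)` (`NodalData.exists_isNode_perturb`).

These potentials are admissible because the number of simple zeros is stable under `C¹`-small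
perturbations that keep the zeros at `0`, `T` and `1` (`exists_stable_zeros`), and because the index
of an eigenvalue is read off from the number of interior zeros. The latter is Sturm's oscillation
theorem (`encard_eigenvalues_lt`), proved here by comparison and shooting.

Minimality up to `O(t²)` gives `∫ φ_p(qhat - q₀) w = 0` for all such `w`. A du Bois-Reymond argument
(`exists_multiplier`) then yields `φ_p(qhat - q₀) = cL E²` on the left of `T` and `cR E²` on the
right. Adding a constant to the potential moves only the eigenvalue, so `w = 1` is admissible as
well, and `cL ∫₀ᵀ E² + cR ∫_T¹ E² = 0`. Hence `(cL, cR)` is proportional to `(a, -b)`, which is the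
Lagrange equation; its factor `c` is nonzero because `qhat ≠ q₀`.

Since `2p* - 2 = 2/(p-1)`, inverting `φ_p` writes `qhat - q₀` as a signed power of the rescaled
eigenfunction. Substitution into the linear eigenvalue equation produces the two nonlinear ones; the
rescaling does not move zeros. -/

namespace InverseNodal

/-! ### Calculus of functions with absolutely continuous derivative -/

/-- `y` is differentiable on `[a,b]` with derivative `v`, and `v` is absolutely continuous with
derivative `r` almost everywhere. -/
structure SecondDeriv (a b : ℝ) (y v r : ℝ → ℝ) : Prop where
  deriv : ∀ x ∈ Icc a b, HasDerivWithinAt y (v x) (Icc a b) x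
  ac : AbsolutelyContinuousOnInterval v a b
  ae : ∀ᵐ x ∂(volume.restrict (Icc a b)), HasDerivAt v (r x) x

theorem hasSecondDerivOn_iff {a b : ℝ} {u w : ℝ → ℝ} :
    HasSecondDerivOn a b u w ↔ ∃ v, SecondDeriv a b u v w :=
  ⟨fun ⟨v, h1, h2, h3⟩ => ⟨v, h1, h2, h3⟩, fun ⟨v, h⟩ => ⟨v, h.deriv, h.ac, h.ae⟩⟩

theorem ae_uIoc_of_ae_Icc {a b : ℝ} (hab : a ≤ b) {P : ℝ → Prop}
    (h : ∀ᵐ x ∂(volume.restrict (Icc a b)), P x) : ∀ᵐ x, x ∈ uIoc a b → P x := by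
  rw [ae_restrict_iff' measurableSet_Icc] at h
  filter_upwards [h] with x hx hx'
  rw [uIoc_of_le hab] at hx'
  exact hx (Ioc_subset_Icc_self hx')

theorem ae_Icc_mem {a b : ℝ} : ∀ᵐ x ∂(volume.restrict (Icc a b)), x ∈ Icc a b :=
  ae_restrict_mem measurableSet_Icc

theorem ae_Icc_mono {a b c d : ℝ} (hac : a ≤ c) (hdb : d ≤ b) {P : ℝ → Prop}
    (h : ∀ᵐ x ∂(volume.restrict (Icc a b)), P x) : ∀ᵐ x ∂(volume.restrict (Icc c d)), P x :=
  ae_restrict_of_ae_restrict_of_subset (Icc_subset_Icc hac hdb) h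

theorem ae_Icc_ne {a b : ℝ} (c : ℝ) : ∀ᵐ x ∂(volume.restrict (Icc a b)), x ≠ c :=
  ae_restrict_of_ae (by simp [ae_iff, measure_singleton])

/-- The fundamental theorem of calculus for absolutely continuous functions. -/
theorem integral_eq_sub_of_ac {a b : ℝ} (hab : a ≤ b) {F f : ℝ → ℝ}
    (hF : AbsolutelyContinuousOnInterval F a b)
    (hd : ∀ᵐ x ∂(volume.restrict (Icc a b)), HasDerivAt F (f x) x) :
    IntervalIntegrable f volume a b ∧ ∫ x in a..b, f x = F b - F a := by
  have h := ae_uIoc_of_ae_Icc hab hd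
  have h' : ∀ᵐ x, x ∈ uIoc a b → _root_.deriv F x = f x := by
    filter_upwards [h] with x hx hx' using (hx hx').deriv
  refine ⟨hF.intervalIntegrable_deriv.congr_ae ?_, ?_⟩
  · rw [Filter.EventuallyEq, ae_restrict_iff' measurableSet_uIoc]
    exact h'
  · rw [← hF.integral_deriv_eq_sub]
    refine intervalIntegral.integral_congr_ae ?_
    filter_upwards [h'] with x hx hx' using (hx hx').symm

theorem ac_of_hasDerivWithinAt {a b : ℝ} (hab : a ≤ b) {y v : ℝ → ℝ}
    (hy : ∀ x ∈ Icc a b, HasDerivWithinAt y (v x) (Icc a b) x) (hv : ContinuousOn v (Icc a b)) :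
    AbsolutelyContinuousOnInterval y a b := by
  obtain ⟨C, hC⟩ := isCompact_Icc.exists_bound_of_continuousOn hv
  have h : LipschitzOnWith C.toNNReal y (Icc a b) := by
    refine (convex_Icc a b).lipschitzOnWith_of_nnnorm_hasDerivWithin_le hy fun x hx => ?_
    have := hC x hx
    rw [← NNReal.coe_le_coe, coe_nnnorm]
    exact this.trans (Real.le_coe_toNNReal C)
  rw [← uIcc_of_le hab] at h
  exact h.absolutelyContinuousOnInterval

theorem hasDerivAt_of_within {a b x : ℝ} {y : ℝ → ℝ} {d : ℝ}
    (h : HasDerivWithinAt y d (Icc a b) x) (hx : x ∈ Ioo a b) : HasDerivAt y d x :=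
  h.hasDerivAt (Icc_mem_nhds hx.1 hx.2)

namespace SecondDeriv

variable {a b : ℝ} {y v r y₁ v₁ r₁ y₂ v₂ r₂ : ℝ → ℝ}

theorem continuousOn (h : SecondDeriv a b y v r) : ContinuousOn y (Icc a b) :=
  fun x hx => (h.deriv x hx).continuousWithinAt

theorem continuousOn_deriv (h : SecondDeriv a b y v r) (hab : a ≤ b) : ContinuousOn v (Icc a b) := by
  have := h.ac.continuousOn
  rwa [uIcc_of_le hab] at this

theorem ac_self (h : SecondDeriv a b y v r) (hab : a ≤ b) : AbsolutelyContinuousOnInterval y a b :=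
  ac_of_hasDerivWithinAt hab h.deriv (h.continuousOn_deriv hab)

theorem ae_self (h : SecondDeriv a b y v r) :
    ∀ᵐ x ∂(volume.restrict (Icc a b)), HasDerivAt y (v x) x := by
  filter_upwards [ae_Icc_mem, ae_Icc_ne a, ae_Icc_ne b] with x hx ha hb
  exact hasDerivAt_of_within (h.deriv x hx) ⟨lt_of_le_of_ne hx.1 ha.symm, lt_of_le_of_ne hx.2 hb⟩

theorem mono (h : SecondDeriv a b y v r) {c d : ℝ} (hac : a ≤ c) (hcd : c ≤ d) (hdb : d ≤ b) :
    SecondDeriv c d y v r where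
  deriv x hx := (h.deriv x ⟨hac.trans hx.1, hx.2.trans hdb⟩).mono (Icc_subset_Icc hac hdb)
  ac := h.ac.mono (by
    rw [uIcc_of_le hcd, uIcc_of_le (hac.trans (hcd.trans hdb))]; exact Icc_subset_Icc hac hdb)
  ae := ae_Icc_mono hac hdb h.ae

theorem congr_ae (h : SecondDeriv a b y v r) (hr : ∀ᵐ x ∂(volume.restrict (Icc a b)), r x = r₁ x) :
    SecondDeriv a b y v r₁ :=
  ⟨h.deriv, h.ac, by filter_upwards [h.ae, hr] with x hx hx' using hx' ▸ hx⟩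

theorem add (h₁ : SecondDeriv a b y₁ v₁ r₁) (h₂ : SecondDeriv a b y₂ v₂ r₂) :
    SecondDeriv a b (fun x => y₁ x + y₂ x) (fun x => v₁ x + v₂ x) (fun x => r₁ x + r₂ x) where
  deriv x hx := (h₁.deriv x hx).add (h₂.deriv x hx)
  ac := h₁.ac.fun_add h₂.ac
  ae := by filter_upwards [h₁.ae, h₂.ae] with x hx hx' using hx.add hx'

theorem const_mul (c : ℝ) (h : SecondDeriv a b y v r) :
    SecondDeriv a b (fun x => c * y x) (fun x => c * v x) (fun x => c * r x) where
  deriv x hx := (h.deriv x hx).const_mul c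
  ac := h.ac.const_mul c
  ae := by filter_upwards [h.ae] with x hx using hx.const_mul c

theorem sub (h₁ : SecondDeriv a b y₁ v₁ r₁) (h₂ : SecondDeriv a b y₂ v₂ r₂) :
    SecondDeriv a b (fun x => y₁ x - y₂ x) (fun x => v₁ x - v₂ x) (fun x => r₁ x - r₂ x) where
  deriv x hx := (h₁.deriv x hx).sub (h₂.deriv x hx)
  ac := h₁.ac.fun_sub h₂.ac
  ae := by filter_upwards [h₁.ae, h₂.ae] with x hx hx' using hx.sub hx'

/-- In the derivative of `v₁ y₂ - y₁ v₂` the products `v₁ v₂` cancel. Both Sturm comparison and the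
solvability of the linearized problem rest on this identity. -/
theorem wronskian (h₁ : SecondDeriv a b y₁ v₁ r₁) (h₂ : SecondDeriv a b y₂ v₂ r₂) (hab : a ≤ b) :
    IntervalIntegrable (fun x => r₁ x * y₂ x - y₁ x * r₂ x) volume a b ∧
    ∫ x in a..b, (r₁ x * y₂ x - y₁ x * r₂ x) =
      (v₁ b * y₂ b - y₁ b * v₂ b) - (v₁ a * y₂ a - y₁ a * v₂ a) := by
  refine integral_eq_sub_of_ac (F := fun x => v₁ x * y₂ x - y₁ x * v₂ x) hab
    ((h₁.ac.fun_mul (h₂.ac_self hab)).fun_sub ((h₁.ac_self hab).fun_mul h₂.ac)) ?_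
  filter_upwards [h₁.ae, h₂.ae, h₁.ae_self, h₂.ae_self] with x a1 a2 b1 b2
  exact ((a1.mul b2).sub (b1.mul a2)).congr_deriv (by ring)

theorem integral_deriv (h : SecondDeriv a b y v r) (hab : a ≤ b) :
    IntervalIntegrable r volume a b ∧ ∫ x in a..b, r x = v b - v a :=
  integral_eq_sub_of_ac hab h.ac h.ae

/-- Taylor's formula with integral remainder, at a base point `z`. -/
theorem taylor (h : SecondDeriv a b y v r) {x z : ℝ} (hx : x ∈ Icc a b) (hz : z ∈ Icc a b) :
    y x = y z + (x - z) * v z + ∫ s in z..x, (x - s) * r s := by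
  have key : ∀ c d : ℝ, a ≤ c → c ≤ d → d ≤ b →
      ∫ s in c..d, (x - s) * r s = (y d + (x - d) * v d) - (y c + (x - c) * v c) := by
    intro c d hc hcd hd
    have h' := h.mono hc hcd hd
    have hl : AbsolutelyContinuousOnInterval (fun s => x - s) c d :=
      ac_of_hasDerivWithinAt (v := fun _ => -1) hcd
        (fun s _ => ((hasDerivAt_id s).const_sub x).hasDerivWithinAt) continuousOn_const
    refine (integral_eq_sub_of_ac (F := fun s => y s + (x - s) * v s) hcd
      ((h'.ac_self hcd).fun_add (hl.fun_mul h'.ac)) ?_).2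
    filter_upwards [h'.ae, h'.ae_self] with s a1 b1
    exact (b1.add (((hasDerivAt_id s).const_sub x).mul a1)).congr_deriv (by simp)
  rcases le_total z x with hzx | hzx
  · rw [key z x hz.1 hzx hx.2]; ring
  · rw [intervalIntegral.integral_symm, key x z hx.1 hzx hz.2]; ring

end SecondDeriv

theorem integrableOn_mul_continuousOn {a b : ℝ} {Q y : ℝ → ℝ} (hQ : IntegrableOn Q (Icc a b))
    (hy : ContinuousOn y (Icc a b)) : IntegrableOn (fun x => Q x * y x) (Icc a b) :=
  hQ.mul_continuousOn hy isCompact_Icc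

theorem intervalIntegrable_of_integrableOn {a b c d : ℝ} {f : ℝ → ℝ} (hf : IntegrableOn f (Icc a b))
    (hc : c ∈ Icc a b) (hd : d ∈ Icc a b) : IntervalIntegrable f volume c d := by
  refine (hf.mono_set ?_).intervalIntegrable
  exact uIcc_subset_Icc hc hd

/-- The second antiderivative of an integrable function, with prescribed initial data. -/
theorem exists_secondDeriv {a b : ℝ} (hab : a ≤ b) {r : ℝ → ℝ} (hr : IntegrableOn r (Icc a b))
    (A B : ℝ) : ∃ y v, Continuous y ∧ SecondDeriv a b y v r ∧ y a = A ∧ v a = B := by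
  have hI : IntervalIntegrable r volume a b :=
    intervalIntegrable_of_integrableOn hr (left_mem_Icc.2 hab) (right_mem_Icc.2 hab)
  -- Extension by zero makes both primitives continuous on the whole line.
  set R : ℝ → ℝ := indicator (Icc a b) r with hR
  have hRi : Integrable R := (integrable_indicator_iff measurableSet_Icc).2 hr
  set v : ℝ → ℝ := fun x => B + ∫ s in a..x, R s with hv
  have hvc : Continuous v := continuous_const.add
    (intervalIntegral.continuous_primitive (fun _ _ => hRi.intervalIntegrable) a)
  refine ⟨fun x => A + ∫ s in a..x, v s, v, ?_, ⟨fun x hx => ?_, ?_, ?_⟩, by simp, by simp [hv]⟩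
  · exact continuous_const.add
      (intervalIntegral.continuous_primitive (fun _ _ => hvc.intervalIntegrable _ _) a)
  · exact ((intervalIntegral.integral_hasDerivAt_right (hvc.intervalIntegrable _ _)
      (hvc.stronglyMeasurableAtFilter _ _) hvc.continuousAt).const_add A).hasDerivWithinAt
  · refine AbsolutelyContinuousOnInterval.fun_add ?_
      (hRi.intervalIntegrable.absolutelyContinuousOnInterval_intervalIntegral left_mem_uIcc)
    exact ac_of_hasDerivWithinAt (v := fun _ => 0) hab
      (fun s _ => (hasDerivAt_const s B).hasDerivWithinAt) continuousOn_const
  · rw [ae_restrict_iff' measurableSet_Icc]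
    filter_upwards [(hRi.intervalIntegrable (a := a) (b := b)).ae_hasDerivAt_integral] with x hx hx'
    have := hx (by rwa [uIcc_of_le hab]) a left_mem_uIcc
    rw [hR, indicator_of_mem hx'] at this
    exact this.const_add B

/-- As `s` lies between `z` and `x`, `|x - z| = |x - s| + |s - z|`, and `M τ ≤ exp (M τ)`. The
gained factor `1 / M` makes the Volterra operator small in the exponentially weighted sup norm. -/
theorem mul_exp_abs_le {M x s z : ℝ} (hM : 0 < M) (hs : s ∈ uIoc z x) :
    |x - s| * Real.exp (M * |s - z|) ≤ Real.exp (M * |x - z|) / M := by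
  have hsum : |x - z| = |x - s| + |s - z| := by
    rcases le_total z x with h | h
    · rw [uIoc_of_le h] at hs
      rw [abs_of_nonneg (by linarith), abs_of_nonneg (by linarith [hs.2]),
        abs_of_nonneg (by linarith [hs.1])]; ring
    · rw [uIoc_of_ge h] at hs
      rw [abs_of_nonpos (by linarith), abs_of_nonpos (by linarith [hs.1]),
        abs_of_nonpos (by linarith [hs.2])]; ring
  rw [le_div_iff₀ hM, hsum, mul_add, Real.exp_add]
  have h1 : |x - s| * M ≤ Real.exp (M * |x - s|) := by
    have := Real.add_one_le_exp (M * |x - s|)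
    linarith
  nlinarith [Real.exp_pos (M * |s - z|)]

/-! ### A priori bounds, uniqueness and existence for the linear initial value problem -/

namespace SecondDeriv

variable {a b : ℝ} {y v r : ℝ → ℝ}

/-- A weighted bound for a function with vanishing Cauchy data at `z`. -/
theorem weighted_bound (h : SecondDeriv 0 1 y v r) {x z M : ℝ} {g : ℝ → ℝ} (hM : 0 < M)
    (hx : x ∈ Icc (0 : ℝ) 1) (hz : z ∈ Icc (0 : ℝ) 1) (hyz : y z = 0) (hvz : v z = 0)
    (hg : IntegrableOn g (Icc 0 1)) (hg0 : ∀ s, 0 ≤ g s)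
    (hr : ∀ᵐ s ∂(volume.restrict (Icc (0 : ℝ) 1)), |r s| ≤ g s * Real.exp (M * |s - z|)) :
    |y x| ≤ Real.exp (M * |x - z|) / M * ∫ s in Icc (0 : ℝ) 1, g s := by
  have hsub : uIoc z x ⊆ Icc 0 1 := uIoc_subset_uIcc.trans (uIcc_subset_Icc hz hx)
  rw [h.taylor hx hz, hyz, hvz, mul_zero, add_zero, zero_add, ← Real.norm_eq_abs]
  refine intervalIntegral.norm_integral_le_integral_norm_uIoc.trans ?_
  have hC : 0 ≤ Real.exp (M * |x - z|) / M := by positivity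
  calc ∫ s in uIoc z x, ‖(x - s) * r s‖
      ≤ ∫ s in uIoc z x, Real.exp (M * |x - z|) / M * g s := by
        refine integral_mono_of_nonneg (ae_of_all _ fun s => norm_nonneg _)
          ((hg.mono_set hsub).const_mul _) ?_
        filter_upwards [ae_restrict_of_ae_restrict_of_subset hsub hr,
          ae_restrict_mem measurableSet_uIoc] with s hs hs'
        have h1 := mul_exp_abs_le hM hs'
        rw [norm_mul, Real.norm_eq_abs, Real.norm_eq_abs]
        calc |x - s| * |r s| ≤ |x - s| * (g s * Real.exp (M * |s - z|)) := by gcongr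
          _ = (|x - s| * Real.exp (M * |s - z|)) * g s := by ring
          _ ≤ _ := mul_le_mul_of_nonneg_right h1 (hg0 s)
    _ ≤ ∫ s in Icc (0 : ℝ) 1, Real.exp (M * |x - z|) / M * g s := by
        refine setIntegral_mono_set (hg.const_mul _)
          (ae_of_all _ fun s => mul_nonneg hC (hg0 s)) (Filter.Eventually.of_forall hsub)
    _ = _ := by rw [integral_const_mul]

/-- A priori bound for solutions of `y'' = Q y + f` with vanishing Cauchy data. -/
theorem apriori (h : SecondDeriv 0 1 y v r) {z : ℝ} (hz : z ∈ Icc (0 : ℝ) 1)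
    (hyz : y z = 0) (hvz : v z = 0) {Q f : ℝ → ℝ}
    (hQ : IntegrableOn Q (Icc 0 1)) (hf : IntegrableOn f (Icc 0 1))
    (hr : ∀ᵐ s ∂(volume.restrict (Icc (0 : ℝ) 1)), |r s| ≤ |Q s| * |y s| + |f s|)
    {A : ℝ} (hA : ∫ s in Icc (0 : ℝ) 1, |Q s| ≤ A) {x : ℝ} (hx : x ∈ Icc (0 : ℝ) 1) :
    |y x| ≤ 2 * Real.exp (2 * A + 2) * ∫ s in Icc (0 : ℝ) 1, |f s| := by
  -- With this weight the weighted maximum `S` of `|y|` satisfies `S ≤ (A S + F) / M`, and the term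
  -- `A S` can be absorbed. The summand `2` keeps `M` positive when `A = 0`.
  set M := 2 * A + 2 with hMdef
  have hA0 : 0 ≤ A := (integral_nonneg fun s => abs_nonneg (Q s)).trans hA
  have hM : 0 < M := by linarith
  have hcont : ContinuousOn (fun x => |y x| * Real.exp (-(M * |x - z|))) (Icc 0 1) :=
    h.continuousOn.abs.mul (by fun_prop)
  obtain ⟨x₀, hx₀, hmax⟩ := isCompact_Icc.exists_isMaxOn ⟨z, hz⟩ hcont
  set S := |y x₀| * Real.exp (-(M * |x₀ - z|)) with hS
  have hS0 : 0 ≤ S := by positivity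
  have hyS : ∀ s ∈ Icc (0 : ℝ) 1, |y s| ≤ S * Real.exp (M * |s - z|) := by
    intro s hs
    have := hmax hs
    simp only [mem_ofPred_eq] at this
    rw [← hS, Real.exp_neg] at this
    rwa [← div_eq_mul_inv, div_le_iff₀ (Real.exp_pos _)] at this
  set F := ∫ s in Icc (0 : ℝ) 1, |f s|
  have hF0 : 0 ≤ F := integral_nonneg fun s => abs_nonneg (f s)
  have hb := h.weighted_bound (g := fun s => |Q s| * S + |f s|) hM hx₀ hz hyz hvz
    ((hQ.abs.mul_const S).add hf.abs) (fun s => by positivity) (by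
      filter_upwards [hr, ae_Icc_mem] with s hs hs'
      have h1 : (1 : ℝ) ≤ Real.exp (M * |s - z|) := Real.one_le_exp (by positivity)
      have h2 := hyS s hs'
      calc |r s| ≤ |Q s| * |y s| + |f s| * 1 := by simpa using hs
        _ ≤ |Q s| * (S * Real.exp (M * |s - z|)) + |f s| * Real.exp (M * |s - z|) := by gcongr
        _ = _ := by ring)
  rw [integral_add (hQ.abs.mul_const S) hf.abs, integral_mul_const] at hb
  have hSb : S ≤ (A * S + F) / M := by
    have h1 : S * Real.exp (M * |x₀ - z|) = |y x₀| := by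
      rw [hS, mul_assoc, ← Real.exp_add]; simp
    refine le_of_mul_le_mul_right ?_ (Real.exp_pos (M * |x₀ - z|))
    rw [h1]
    refine hb.trans ?_
    rw [div_mul_eq_mul_div, div_mul_eq_mul_div, mul_comm (Real.exp _)]
    gcongr
  have hS2 : S ≤ 2 * F := by
    rw [le_div_iff₀ hM] at hSb
    nlinarith
  have h1 : |x - z| ≤ 1 := by rw [abs_le]; constructor <;> linarith [hx.1, hx.2, hz.1, hz.2]
  calc |y x| ≤ S * Real.exp (M * |x - z|) := hyS x hx
    _ ≤ (2 * F) * Real.exp (M * 1) := by gcongr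
    _ = _ := by rw [mul_one]; ring

theorem abs_deriv_sub_le (h : SecondDeriv 0 1 y v r) {x z : ℝ} (hx : x ∈ Icc (0 : ℝ) 1)
    (hz : z ∈ Icc (0 : ℝ) 1) : |v x - v z| ≤ ∫ s in Icc (0 : ℝ) 1, |r s| := by
  have hri : IntegrableOn r (Icc 0 1) := by
    rw [← intervalIntegrable_iff_integrableOn_Icc_of_le zero_le_one]
    exact (h.integral_deriv zero_le_one).1
  have hsub : uIoc z x ⊆ Icc 0 1 := uIoc_subset_uIcc.trans (uIcc_subset_Icc hz hx)
  have h1 : v x - v z = ∫ s in z..x, r s := by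
    rcases le_total z x with hzx | hzx
    · rw [((h.mono hz.1 hzx hx.2).integral_deriv hzx).2]
    · rw [intervalIntegral.integral_symm, ((h.mono hx.1 hzx hz.2).integral_deriv hzx).2]; ring
  rw [h1, ← Real.norm_eq_abs]
  exact intervalIntegral.norm_integral_le_integral_norm_uIoc.trans
    (setIntegral_mono_set hri.abs (ae_of_all _ fun s => abs_nonneg _)
      (Filter.Eventually.of_forall hsub))

/-- Solutions of `y'' = Q y` with vanishing Cauchy data at one point vanish. -/
theorem eq_zero (h : SecondDeriv 0 1 y v r) {z : ℝ} (hz : z ∈ Icc (0 : ℝ) 1)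
    (hyz : y z = 0) (hvz : v z = 0) {Q : ℝ → ℝ} (hQ : IntegrableOn Q (Icc 0 1))
    (hr : ∀ᵐ s ∂(volume.restrict (Icc (0 : ℝ) 1)), r s = Q s * y s) {x : ℝ}
    (hx : x ∈ Icc (0 : ℝ) 1) : y x = 0 := by
  have := h.apriori hz hyz hvz hQ (integrable_zero ..) (by
    filter_upwards [hr] with s hs
    simp [hs, abs_mul]) le_rfl hx
  simpa using this

end SecondDeriv

/-- Existence for the linear initial value problem `y'' = Q y + f` with integrable `Q` and `f`. -/
theorem exists_solution {Q f : ℝ → ℝ} (hQ : IntegrableOn Q (Icc 0 1))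
    (hf : IntegrableOn f (Icc 0 1)) (A B : ℝ) :
    ∃ y v, SecondDeriv 0 1 y v (fun x => Q x * y x + f x) ∧ y 0 = A ∧ v 0 = B := by
  set M := 2 * (∫ s in Icc (0 : ℝ) 1, |Q s|) + 2 with hMdef
  have hQ0 : 0 ≤ ∫ s in Icc (0 : ℝ) 1, |Q s| := integral_nonneg fun s => abs_nonneg (Q s)
  have hM : 0 < M := by linarith
  -- The unknown is `u = exp (-M x) y`: the plain sup distance on `C[0,1]` is then the weighted one
  -- for `y`, and the choice of `M` gives contraction constant `1/2`.
  let ext : C(Icc (0 : ℝ) 1, ℝ) → ℝ → ℝ := fun u x =>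
    Real.exp (M * x) * u (projIcc 0 1 zero_le_one x)
  have hext : ∀ u, Continuous (ext u) := fun u =>
    (by fun_prop : Continuous fun x : ℝ => Real.exp (M * x)).mul
      (u.continuous.comp continuous_projIcc)
  have hex : ∀ u : C(Icc (0 : ℝ) 1, ℝ), ∃ y v, Continuous y ∧
      SecondDeriv 0 1 y v (fun x => Q x * ext u x + f x) ∧ y 0 = A ∧ v 0 = B := fun u =>
    exists_secondDeriv zero_le_one
      ((integrableOn_mul_continuousOn hQ (hext u).continuousOn).add hf) A B
  choose Y V hYc hYV hY0 hV0 using hex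
  let Φ : C(Icc (0 : ℝ) 1, ℝ) → C(Icc (0 : ℝ) 1, ℝ) := fun u =>
    ⟨fun x => Real.exp (-(M * x)) * Y u x,
      (by fun_prop : Continuous fun x : Icc (0 : ℝ) 1 => Real.exp (-(M * (x : ℝ)))).mul
        ((hYc u).comp continuous_subtype_val)⟩
  have hΦ : ContractingWith (1 / 2) Φ := by
    refine ⟨by rw [← NNReal.coe_lt_coe]; norm_num, LipschitzWith.of_dist_le_mul fun u₁ u₂ => ?_⟩
    rw [ContinuousMap.dist_le (by positivity)]
    intro x
    have hd := (hYV u₁).sub (hYV u₂)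
    have hb := hd.weighted_bound (x := x) (z := 0) (g := fun s => |Q s| * dist u₁ u₂) hM x.2
      (left_mem_Icc.2 zero_le_one) (by simp [hY0]) (by simp [hV0]) (hQ.abs.mul_const _)
      (fun s => by positivity) (by
        filter_upwards [ae_Icc_mem] with s hs
        have e : Q s * ext u₁ s + f s - (Q s * ext u₂ s + f s) =
            Q s * Real.exp (M * s) *
              (u₁ (projIcc 0 1 zero_le_one s) - u₂ (projIcc 0 1 zero_le_one s)) := by
          simp only [ext]; ring
        have h2 : |u₁ (projIcc 0 1 zero_le_one s) - u₂ (projIcc 0 1 zero_le_one s)| ≤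
            dist u₁ u₂ := by
          rw [← Real.dist_eq]; exact ContinuousMap.dist_apply_le_dist _
        rw [e, sub_zero, abs_of_nonneg hs.1, abs_mul, abs_mul, abs_of_pos (Real.exp_pos _)]
        calc _ ≤ |Q s| * Real.exp (M * s) * dist u₁ u₂ := by gcongr
          _ = _ := by ring)
    rw [integral_mul_const, sub_zero, abs_of_nonneg x.2.1] at hb
    change |Real.exp (-(M * x)) * Y u₁ x - Real.exp (-(M * x)) * Y u₂ x| ≤ _
    rw [← mul_sub, abs_mul, abs_of_pos (Real.exp_pos _), Real.exp_neg, inv_mul_le_iff₀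
      (Real.exp_pos _)]
    refine hb.trans ?_
    rw [div_mul_eq_mul_div, div_le_iff₀ hM]
    have h3 : (∫ s in Icc (0 : ℝ) 1, |Q s|) ≤ 1 / 2 * M := by rw [hMdef]; linarith
    have h4 : (0 : ℝ) ≤ dist u₁ u₂ := dist_nonneg
    push_cast
    calc Real.exp (M * x) * ((∫ s in Icc (0 : ℝ) 1, |Q s|) * dist u₁ u₂)
        ≤ Real.exp (M * x) * ((1 / 2 * M) * dist u₁ u₂) := by gcongr
      _ = _ := by ring
  set u := ContractingWith.fixedPoint Φ hΦ
  have hu : Φ u = u := hΦ.fixedPoint_isFixedPt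
  refine ⟨Y u, V u, (hYV u).congr_ae ?_, hY0 u, hV0 u⟩
  filter_upwards [ae_Icc_mem] with x hx
  have h1 : u ⟨x, hx⟩ = Real.exp (-(M * x)) * Y u x := by
    conv_lhs => rw [← hu]
    rfl
  simp only [ext, projIcc_of_mem zero_le_one hx, h1]
  rw [← mul_assoc (Real.exp _), ← Real.exp_add]
  simp

/-! ### Stability of the number of simple zeros -/

/-- Two zeros of a function enclose a zero of its derivative. -/
theorem exists_deriv_eq_zero_of_zeros {a b x y : ℝ} {f g : ℝ → ℝ}
    (hd : ∀ x ∈ Icc a b, HasDerivWithinAt f (g x) (Icc a b) x) (hx : x ∈ Icc a b)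
    (hy : y ∈ Icc a b) (hxy : x < y) (hfx : f x = 0) (hfy : f y = 0) : ∃ w ∈ Ioo x y, g w = 0 := by
  have hsub : Icc x y ⊆ Icc a b := Icc_subset_Icc hx.1 hy.2
  refine exists_hasDerivAt_eq_zero (f := f) hxy
    (fun w hw => (hd w (hsub hw)).continuousWithinAt.mono hsub) (by rw [hfx, hfy]) fun w hw => ?_
  exact hasDerivAt_of_within ((hd w (hsub (Ioo_subset_Icc_self hw))).mono hsub) hw

/-- By the mean value theorem `h` rises by at least `c * r` on either side of `z`, more than `|h
z|`, so it changes sign within distance `r`. -/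
theorem exists_root_of_le_deriv {a b c r z : ℝ} {h k : ℝ → ℝ} (hr : 0 < r)
    (hd : ∀ x ∈ Icc a b, HasDerivWithinAt h (k x) (Icc a b) x) (ha : a ≤ z - r) (hb : z + r ≤ b)
    (hk : ∀ y ∈ Icc a b, |y - z| ≤ r → c ≤ k y) (hz : |h z| < c * r) :
    ∃ w ∈ Ioo (z - r) (z + r), h w = 0 := by
  have hsub : Icc (z - r) (z + r) ⊆ Icc a b := Icc_subset_Icc ha hb
  have hcont : ContinuousOn h (Icc (z - r) (z + r)) :=
    fun w hw => (hd w (hsub hw)).continuousWithinAt.mono hsub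
  have hder : ∀ w ∈ Ioo (z - r) (z + r), HasDerivAt h (k w) w := fun w hw =>
    hasDerivAt_of_within ((hd w (hsub (Ioo_subset_Icc_self hw))).mono hsub) hw
  have slope : ∀ s t, z - r ≤ s → s < t → t ≤ z + r → c * (t - s) ≤ h t - h s := by
    intro s t hs hst ht
    obtain ⟨w, hw, hw'⟩ := exists_hasDerivAt_eq_slope h k hst
      (hcont.mono (Icc_subset_Icc hs ht)) fun w hw => hder w ⟨by linarith [hw.1], by linarith [hw.2]⟩
    rw [eq_div_iff (by linarith)] at hw'
    rw [← hw']
    refine mul_le_mul_of_nonneg_right (hk w (hsub ⟨by linarith [hw.1], by linarith [hw.2]⟩) ?_)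
      (by linarith)
    rw [abs_le]; constructor <;> linarith [hw.1, hw.2]
  have h1 := slope (z - r) z le_rfl (by linarith) (by linarith)
  have h2 := slope z (z + r) (by linarith) (by linarith) le_rfl
  rw [abs_lt] at hz
  rw [show z - (z - r) = r by ring] at h1
  rw [show z + r - z = r by ring] at h2
  obtain ⟨w, hw, hw0⟩ := intermediate_value_Ioo (by linarith : z - r ≤ z + r) hcont
    (show (0 : ℝ) ∈ Ioo (h (z - r)) (h (z + r)) from ⟨by linarith, by linarith⟩)
  exact ⟨w, hw, hw0⟩

/-- A quantitative form of the assertion that `f` has only simple zeros in `[a,b]`: where `f` is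
small its derivative `g` has constant sign and is bounded away from zero at scale `r`, and interior
zeros stay away from the end points. -/
structure Spread (a b c r : ℝ) (f g : ℝ → ℝ) : Prop where
  deriv : ∀ x ∈ Icc a b, HasDerivWithinAt f (g x) (Icc a b) x
  sign : ∀ x ∈ Icc a b, |f x| < c * r → (∀ y ∈ Icc a b, |y - x| ≤ r → c ≤ g y) ∨
    (∀ y ∈ Icc a b, |y - x| ≤ r → g y ≤ -c)
  inner : ∀ z ∈ Ioo a b, f z = 0 → a ≤ z - r ∧ z + r ≤ b

/-- By Rolle, two distinct zeros within `r` of `x` would enclose a zero of `g`, which has a strict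
sign there. -/
theorem eq_of_sign {a b c r x y z : ℝ} {f g : ℝ → ℝ} (hc : 0 < c)
    (hd : ∀ x ∈ Icc a b, HasDerivWithinAt f (g x) (Icc a b) x)
    (hs : (∀ y ∈ Icc a b, |y - x| ≤ r → c ≤ g y) ∨ (∀ y ∈ Icc a b, |y - x| ≤ r → g y ≤ -c))
    (hy : y ∈ Icc a b) (hz : z ∈ Icc a b) (hyx : |y - x| ≤ r) (hzx : |z - x| ≤ r)
    (hfy : f y = 0) (hfz : f z = 0) : y = z := by
  have key : ∀ y z, y ∈ Icc a b → z ∈ Icc a b → |y - x| ≤ r → |z - x| ≤ r → f y = 0 → f z = 0 →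
      ¬ y < z := by
    intro y z hy hz hyx hzx hfy hfz hlt
    obtain ⟨w, hw, hw0⟩ := exists_deriv_eq_zero_of_zeros hd hy hz hlt hfy hfz
    have hwI : w ∈ Icc a b := ⟨hy.1.trans hw.1.le, hw.2.le.trans hz.2⟩
    have hwr : |w - x| ≤ r := by
      rw [abs_le] at *; constructor <;> linarith [hw.1, hw.2]
    rcases hs with hs | hs
    · have := hs w hwI hwr; linarith
    · have := hs w hwI hwr; linarith
  exact le_antisymm (not_lt.1 (key z y hz hy hzx hyx hfz hfy))
    (not_lt.1 (key y z hy hz hyx hzx hfy hfz))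

/-- Each zero of `f` is sent to a zero of `h` at distance less than `r`. If two zeros of `f` had the
same image, both would lie within `r` of a point where `f` is small, hence coincide. The hypotheses
are symmetric in `f` and `h`, so equality follows by exchanging them. -/
theorem Spread.encard_le {a b c r : ℝ} {f g h k : ℝ → ℝ} (hc : 0 < c) (hr : 0 < r)
    (hf : Spread a b c r f g) (hh : Spread a b c r h k)
    (hfh : ∀ x ∈ Icc a b, |f x - h x| < c * r) :
    {x ∈ Ioo a b | f x = 0}.encard ≤ {x ∈ Ioo a b | h x = 0}.encard := by
  have hex : ∀ z, z ∈ {x ∈ Ioo a b | f x = 0} → ∃ w ∈ Ioo (z - r) (z + r), h w = 0 := by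
    rintro z ⟨hz, hfz⟩
    obtain ⟨ha, hb⟩ := hf.inner z hz hfz
    have hzI := Ioo_subset_Icc_self hz
    have hsmall : |h z| < c * r := by
      have := hfh z hzI
      rwa [hfz, zero_sub, abs_neg] at this
    rcases hh.sign z hzI hsmall with hs | hs
    · exact exists_root_of_le_deriv hr hh.deriv ha hb hs hsmall
    · obtain ⟨w, hw, hw0⟩ := exists_root_of_le_deriv (c := c) (h := fun x => -h x) (k := fun x => -k x) hr
        (fun x hx => (hh.deriv x hx).neg) ha hb
        (fun y hy hyz => by have := hs y hy hyz; linarith) (by rwa [abs_neg])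
      exact ⟨w, hw, by simpa using hw0⟩
  choose! ψ hψ hψ0 using hex
  refine encard_le_encard_of_injOn (f := ψ) (fun z hz => ?_) fun z hz z' hz' heq => ?_
  · obtain ⟨ha, hb⟩ := hf.inner z hz.1 hz.2
    have := hψ z hz
    exact ⟨⟨by linarith [this.1], by linarith [this.2]⟩, hψ0 z hz⟩
  · obtain ⟨ha, hb⟩ := hf.inner z hz.1 hz.2
    have h1 := hψ z hz
    have h2 := hψ z' hz'
    have hwI : ψ z ∈ Icc a b := ⟨by linarith [h1.1], by linarith [h1.2]⟩
    have hsmall : |f (ψ z)| < c * r := by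
      have := hfh _ hwI
      rwa [hψ0 z hz, sub_zero] at this
    refine eq_of_sign hc hf.deriv (hf.sign _ hwI hsmall) (Ioo_subset_Icc_self hz.1)
      (Ioo_subset_Icc_self hz'.1) ?_ ?_ hz.2 hz'.2
    · rw [abs_le]; constructor <;> linarith [h1.1, h1.2]
    · rw [heq, abs_le]; constructor <;> linarith [h2.1, h2.2]

/-- The number of interior zeros is stable under `C¹`-small perturbations that keep the zero at the
left end point and, if there is one, the zero at the right end point. -/
theorem exists_stable_zeros {a b : ℝ} (hab : a < b) {f g : ℝ → ℝ}
    (hd : ∀ x ∈ Icc a b, HasDerivWithinAt f (g x) (Icc a b) x) (hg : ContinuousOn g (Icc a b))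
    (hfa : f a = 0) (hsimple : ∀ x ∈ Icc a b, f x = 0 → g x ≠ 0) :
    ∃ δ > 0, ∀ h k : ℝ → ℝ, (∀ x ∈ Icc a b, HasDerivWithinAt h (k x) (Icc a b) x) →
      (∀ x ∈ Icc a b, |f x - h x| < δ) → (∀ x ∈ Icc a b, |g x - k x| < δ) → h a = 0 →
      (f b = 0 → h b = 0) →
      {x ∈ Ioo a b | f x = 0}.encard = {x ∈ Ioo a b | h x = 0}.encard := by
  have hf : ContinuousOn f (Icc a b) := fun x hx => (hd x hx).continuousWithinAt
  obtain ⟨x₀, hx₀, hmin⟩ := isCompact_Icc.exists_isMinOn (nonempty_Icc.2 hab.le)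
    (hf.abs.add hg.abs)
  have hpos : 0 < |f x₀| + |g x₀| := by
    rcases eq_or_ne (f x₀) 0 with h0 | h0
    · have := abs_pos.2 (hsimple x₀ hx₀ h0); positivity
    · have := abs_pos.2 h0; positivity
  -- Where `|f| < 2cr ≤ 2c`, the bound `6c` leaves `|g| ≥ 4c`. The oscillation of `g` at scale `r`
  -- and the perturbation each cost at most `c`, which leaves more than the `c` required by
  -- `Spread`. The bound `4c ≤ |f b|` excludes zeros near a right end point at which `f` does not
  -- vanish.
  obtain ⟨c, hc, hcm, hcb⟩ : ∃ c > 0, 6 * c ≤ |f x₀| + |g x₀| ∧ (f b ≠ 0 → 4 * c ≤ |f b|) := by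
    by_cases hb : f b = 0
    · exact ⟨(|f x₀| + |g x₀|) / 6, by positivity, by linarith, fun h => absurd hb h⟩
    · have := abs_pos.2 hb
      refine ⟨min ((|f x₀| + |g x₀|) / 6) (|f b| / 4), by positivity, ?_, fun _ => ?_⟩
      · linarith [min_le_left ((|f x₀| + |g x₀|) / 6) (|f b| / 4)]
      · linarith [min_le_right ((|f x₀| + |g x₀|) / 6) (|f b| / 4)]
  have hfu := Metric.uniformContinuousOn_iff.1 (isCompact_Icc.uniformContinuousOn_of_continuous hf) c hc
  have hgu := Metric.uniformContinuousOn_iff.1 (isCompact_Icc.uniformContinuousOn_of_continuous hg) c hc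
  obtain ⟨r₁, hr₁, hfu⟩ := hfu
  obtain ⟨r₂, hr₂, hgu⟩ := hgu
  obtain ⟨r, hr, hr1, hrr₁, hrr₂⟩ : ∃ r > 0, r ≤ 1 ∧ r < r₁ ∧ r < r₂ := by
    refine ⟨min 1 (min (r₁ / 2) (r₂ / 2)), by positivity, min_le_left _ _, ?_, ?_⟩
    · linarith [(min_le_right (1 : ℝ) (min (r₁ / 2) (r₂ / 2))).trans (min_le_left _ _)]
    · linarith [(min_le_right (1 : ℝ) (min (r₁ / 2) (r₂ / 2))).trans (min_le_right _ _)]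
  have hcr : c * r ≤ c := by nlinarith
  have hcr0 : 0 < c * r := by positivity
  -- the strengthened sign condition for `f`
  have hsign : ∀ x ∈ Icc a b, |f x| < 2 * (c * r) →
      (∀ y ∈ Icc a b, |y - x| ≤ r → 2 * c ≤ g y) ∨ (∀ y ∈ Icc a b, |y - x| ≤ r → g y ≤ -(2 * c)) := by
    intro x hx hfx
    have h1 : |f x₀| + |g x₀| ≤ |f x| + |g x| := hmin hx
    have h2 : 4 * c ≤ |g x| := by linarith
    have h3 : ∀ y ∈ Icc a b, |y - x| ≤ r → |g y - g x| < c := fun y hy hyx =>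
      hgu y hy x hx (lt_of_le_of_lt hyx hrr₂)
    rcases le_abs.1 h2 with h | h
    · left; intro y hy hyx
      have := abs_lt.1 (h3 y hy hyx); linarith
    · right; intro y hy hyx
      have := abs_lt.1 (h3 y hy hyx); linarith
  have hfar : f b ≠ 0 → ∀ z ∈ Icc a b, b < z + r → 2 * (c * r) < |f z| := by
    intro hb z hz hzr
    have h1 : |f z - f b| < c := hfu z hz b (right_mem_Icc.2 hab.le) (by
      rw [Real.dist_eq, abs_lt]; constructor <;> linarith [hz.2])
    have h2 := hcb hb
    have h3 := abs_sub_abs_le_abs_sub (f b) (f z)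
    rw [abs_sub_comm] at h3
    linarith
  have hinner : ∀ h k : ℝ → ℝ, (∀ x ∈ Icc a b, HasDerivWithinAt h (k x) (Icc a b) x) →
      (∀ x ∈ Icc a b, |f x - h x| < c * r) → h a = 0 → (f b = 0 → h b = 0) →
      (∀ x ∈ Icc a b, |h x| < c * r → (∀ y ∈ Icc a b, |y - x| ≤ r → c ≤ k y) ∨
        (∀ y ∈ Icc a b, |y - x| ≤ r → k y ≤ -c)) → Spread a b c r h k := by
    intro h k hd' hfh ha hb hs
    refine ⟨hd', hs, fun z hz hz0 => ?_⟩
    have hzI := Ioo_subset_Icc_self hz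
    have hsz := hs z hzI (by rwa [hz0, abs_zero])
    constructor
    · by_contra hlt
      have := eq_of_sign hc hd' hsz (left_mem_Icc.2 hab.le) hzI
        (by rw [abs_le]; constructor <;> linarith [hz.1]) (by simp [hr.le]) ha hz0
      exact hz.1.ne this
    · by_contra hlt
      by_cases hfb : f b = 0
      · have := eq_of_sign hc hd' hsz (right_mem_Icc.2 hab.le) hzI
          (by rw [abs_le]; constructor <;> linarith [hz.2]) (by simp [hr.le]) (hb hfb) hz0
        exact hz.2.ne' this
      · have h1 := hfar hfb z hzI (not_le.1 hlt)
        have h2 := hfh z hzI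
        rw [hz0, sub_zero] at h2
        linarith
  have hSf : Spread a b c r f g := by
    refine hinner f g hd (by simpa using fun _ _ _ => hcr0) hfa id fun x hx hfx => ?_
    refine (hsign x hx (by linarith)).imp (fun h y hy hyx => ?_) fun h y hy hyx => ?_
    · linarith [h y hy hyx]
    · linarith [h y hy hyx]
  refine ⟨c * r, hcr0, fun h k hd' hfh hgk ha hb => ?_⟩
  have hSh : Spread a b c r h k := by
    refine hinner h k hd' hfh ha hb fun x hx hhx => ?_
    have h0 : |f x| < 2 * (c * r) := by
      have h1 := hfh x hx
      have h2 := abs_sub_abs_le_abs_sub (f x) (h x)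
      linarith
    refine (hsign x hx h0).imp (fun h y hy hyx => ?_) fun h y hy hyx => ?_
    · have := abs_lt.1 (hgk y hy); linarith [h y hy hyx]
    · have := abs_lt.1 (hgk y hy); linarith [h y hy hyx]
  exact le_antisymm (hSf.encard_le hc hr hSh hfh)
    (hSh.encard_le hc hr hSf fun x hx => by rw [abs_sub_comm]; exact hfh x hx)

/-- When the right end point is a zero of `f`, a `C¹`-small perturbation that keeps the zero at the
left end point has at least as many interior zeros, and at most one more. -/
theorem exists_stable_zeros_succ {a b : ℝ} (hab : a < b) {f g : ℝ → ℝ}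
    (hd : ∀ x ∈ Icc a b, HasDerivWithinAt f (g x) (Icc a b) x) (hg : ContinuousOn g (Icc a b))
    (hfa : f a = 0) (hfb : f b = 0) (hsimple : ∀ x ∈ Icc a b, f x = 0 → g x ≠ 0) :
    ∃ δ > 0, ∀ h k : ℝ → ℝ, (∀ x ∈ Icc a b, HasDerivWithinAt h (k x) (Icc a b) x) →
      (∀ x ∈ Icc a b, |f x - h x| < δ) → (∀ x ∈ Icc a b, |g x - k x| < δ) → h a = 0 →
      {x ∈ Ioo a b | f x = 0}.encard ≤ {x ∈ Ioo a b | h x = 0}.encard ∧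
      {x ∈ Ioo a b | h x = 0}.encard ≤ {x ∈ Ioo a b | f x = 0}.encard + 1 := by
  have hbI := right_mem_Icc.2 hab.le
  have hgb : 0 < |g b| := abs_pos.2 (hsimple b hbI hfb)
  obtain ⟨ρ, hρ, hgρ⟩ := Metric.continuousOn_iff.1 hg b hbI (|g b| / 2) (by positivity)
  -- On `[b', b]` the derivative `g` stays away from `0`, so `b` is the only zero of `f` there. The
  -- stability result applies on `[a, b']`, where `f b' ≠ 0`; by Rolle the perturbed function has at
  -- most one zero in `[b', b)`.
  obtain ⟨b', hb'a, hb'b, hb'ρ⟩ : ∃ b', a < b' ∧ b' < b ∧ b - ρ < b' := by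
    refine ⟨max ((a + b) / 2) (b - ρ / 2), ?_, ?_, ?_⟩
    · exact lt_max_of_lt_left (by linarith)
    · exact max_lt (by linarith) (by linarith)
    · exact lt_max_of_lt_right (by linarith)
  have hgne : ∀ y ∈ Icc b' b, |g b| / 2 ≤ |g y| := by
    intro y hy
    have h1 := hgρ y ⟨hb'a.le.trans hy.1, hy.2⟩ (by
      rw [Real.dist_eq, abs_lt]; constructor <;> linarith [hy.1, hy.2])
    rw [Real.dist_eq, abs_sub_comm] at h1
    have h2 := abs_sub_abs_le_abs_sub (g b) (g y)
    linarith
  have hsub : Icc a b' ⊆ Icc a b := Icc_subset_Icc_right hb'b.le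
  have hfne : ∀ y ∈ Ico b' b, f y ≠ 0 := by
    intro y hy h0
    obtain ⟨w, hw, hw0⟩ := exists_deriv_eq_zero_of_zeros hd ⟨hb'a.le.trans hy.1, hy.2.le⟩ hbI
      hy.2 h0 hfb
    have := hgne w ⟨hy.1.trans hw.1.le, hw.2.le⟩
    rw [hw0, abs_zero] at this
    linarith
  obtain ⟨δ, hδ, hst⟩ := exists_stable_zeros hb'a
    (fun x hx => (hd x (hsub hx)).mono hsub) (hg.mono hsub) hfa (fun x hx => hsimple x (hsub hx))
  refine ⟨min δ (|g b| / 2), by positivity, fun h k hdh hfh hgk ha => ?_⟩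
  have heq := hst h k (fun x hx => (hdh x (hsub hx)).mono hsub)
    (fun x hx => (hfh x (hsub hx)).trans_le (min_le_left _ _))
    (fun x hx => (hgk x (hsub hx)).trans_le (min_le_left _ _)) ha
    (fun h0 => absurd h0 (hfne b' ⟨le_rfl, hb'b⟩))
  have hfeq : {x ∈ Ioo a b | f x = 0} = {x ∈ Ioo a b' | f x = 0} := by
    ext x
    constructor
    · rintro ⟨hx, h0⟩
      exact ⟨⟨hx.1, not_le.1 fun hle => hfne x ⟨hle, hx.2⟩ h0⟩, h0⟩
    · rintro ⟨hx, h0⟩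
      exact ⟨⟨hx.1, hx.2.trans hb'b⟩, h0⟩
  rw [hfeq, heq]
  refine ⟨encard_le_encard fun x hx => ⟨⟨hx.1.1, hx.1.2.trans hb'b⟩, hx.2⟩, ?_⟩
  have hone : {x ∈ Ico b' b | h x = 0}.encard ≤ 1 := by
    rw [encard_le_one_iff]
    have key : ∀ x y, x ∈ {x ∈ Ico b' b | h x = 0} → y ∈ {x ∈ Ico b' b | h x = 0} → ¬ x < y := by
      rintro x y ⟨hx, hx0⟩ ⟨hy, hy0⟩ hxy
      obtain ⟨w, hw, hw0⟩ := exists_deriv_eq_zero_of_zeros hdh ⟨hb'a.le.trans hx.1, hx.2.le⟩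
        ⟨hb'a.le.trans hy.1, hy.2.le⟩ hxy hx0 hy0
      have hwI : w ∈ Icc b' b := ⟨hx.1.trans hw.1.le, hw.2.le.trans hy.2.le⟩
      have h1 := hgk w ⟨hb'a.le.trans hwI.1, hwI.2⟩
      rw [hw0, sub_zero] at h1
      exact absurd (h1.trans_le (min_le_right _ _)) (not_lt.2 (hgne w hwI))
    exact fun x y hx hy => le_antisymm (not_lt.1 (key y x hy hx)) (not_lt.1 (key x y hx hy))
  calc _ ≤ ({x ∈ Ioo a b' | h x = 0} ∪ {x ∈ Ico b' b | h x = 0}).encard := by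
        refine encard_le_encard fun x hx => ?_
        rcases lt_or_ge x b' with hlt | hle
        · exact Or.inl ⟨⟨hx.1.1, hlt⟩, hx.2⟩
        · exact Or.inr ⟨⟨hle, hx.1.2⟩, hx.2⟩
    _ ≤ _ := (encard_union_le _ _).trans (by gcongr)

/-! ### Sturm comparison -/

theorem const_sign_of_ne_zero {a b : ℝ} {y : ℝ → ℝ} (hy : ContinuousOn y (Ioo a b))
    (h0 : ∀ x ∈ Ioo a b, y x ≠ 0) : (∀ x ∈ Ioo a b, 0 < y x) ∨ (∀ x ∈ Ioo a b, y x < 0) := by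
  by_contra hcon
  push Not at hcon
  obtain ⟨⟨s, hs, hys⟩, t, ht, hyt⟩ := hcon
  obtain ⟨w, hw, hw0⟩ := isPreconnected_Ioo.intermediate_value hs ht hy ⟨hys, hyt⟩
  exact h0 w hw hw0

theorem nonneg_on_Icc_of_pos {a b : ℝ} (hab : a < b) {y : ℝ → ℝ} (hy : ContinuousOn y (Icc a b))
    (h0 : ∀ x ∈ Ioo a b, 0 < y x) : ∀ x ∈ Icc a b, 0 ≤ y x := by
  have hcl := closure_Ioo hab.ne
  intro x hx
  refine le_on_closure (f := fun _ => (0 : ℝ)) (fun x hx => (h0 x hx).le) continuousOn_const ?_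
    (hcl ▸ hx)
  rwa [hcl]

theorem deriv_left_nonneg {a b d : ℝ} (hab : a < b) {y : ℝ → ℝ}
    (hd : HasDerivWithinAt y d (Icc a b) a) (hya : y a = 0) (h0 : ∀ x ∈ Icc a b, 0 ≤ y x) :
    0 ≤ d := by
  rw [hasDerivWithinAt_iff_tendsto_slope, Icc_sdiff_left] at hd
  have : (nhdsWithin a (Ioc a b)).NeBot := by
    rw [nhdsWithin_Ioc_eq_nhdsGT hab]; infer_instance
  refine ge_of_tendsto hd ?_
  filter_upwards [self_mem_nhdsWithin] with x hx
  rw [slope_def_field, hya, sub_zero]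
  exact div_nonneg (h0 x (Ioc_subset_Icc_self hx)) (by linarith [hx.1])

theorem deriv_right_nonpos {a b d : ℝ} (hab : a < b) {y : ℝ → ℝ}
    (hd : HasDerivWithinAt y d (Icc a b) b) (hyb : y b = 0) (h0 : ∀ x ∈ Icc a b, 0 ≤ y x) :
    d ≤ 0 := by
  rw [hasDerivWithinAt_iff_tendsto_slope, Icc_sdiff_right] at hd
  have : (nhdsWithin b (Ico a b)).NeBot := by
    rw [nhdsWithin_Ico_eq_nhdsLT hab]; infer_instance
  refine le_of_tendsto hd ?_
  filter_upwards [self_mem_nhdsWithin] with x hx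
  rw [slope_def_field, hyb, sub_zero]
  exact div_nonpos_of_nonneg_of_nonpos (h0 x (Ico_subset_Icc_self hx)) (by linarith [hx.2])

/-- The integral of `(Q₁ - Q₂) y₁ y₂` is strictly positive. By the Wronskian identity it equals
boundary terms that are nonpositive, since `y₁` leaves `0` upwards at `a` and returns to it at `b`.
-/
theorem sturm_comparison_aux {a b : ℝ} (hab : a < b) {y₁ v₁ y₂ v₂ Q₁ Q₂ : ℝ → ℝ}
    (h₁ : SecondDeriv a b y₁ v₁ (fun x => Q₁ x * y₁ x))
    (h₂ : SecondDeriv a b y₂ v₂ (fun x => Q₂ x * y₂ x))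
    (hQ : ∀ᵐ x ∂(volume.restrict (Icc a b)), Q₂ x < Q₁ x) (ha : y₁ a = 0) (hb : y₁ b = 0)
    (hp₁ : ∀ x ∈ Ioo a b, 0 < y₁ x) (hp₂ : ∀ x ∈ Ioo a b, 0 < y₂ x) : False := by
  obtain ⟨hint, hW⟩ := h₁.wronskian h₂ hab.le
  have hn₁ := nonneg_on_Icc_of_pos hab h₁.continuousOn hp₁
  have hn₂ := nonneg_on_Icc_of_pos hab h₂.continuousOn hp₂
  have haI := left_mem_Icc.2 hab.le
  have hbI := right_mem_Icc.2 hab.le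
  have hva := deriv_left_nonneg hab (h₁.deriv a haI) ha hn₁
  have hvb := deriv_right_nonpos hab (h₁.deriv b hbI) hb hn₁
  have hle : ∫ x in a..b, (Q₁ x * y₁ x * y₂ x - y₁ x * (Q₂ x * y₂ x)) ≤ 0 := by
    rw [hW, ha, hb]
    have := mul_nonneg hva (hn₂ a haI)
    have := mul_nonpos_of_nonpos_of_nonneg hvb (hn₂ b hbI)
    linarith
  have hpos : ∀ᵐ x ∂(volume.restrict (Ioc a b)),
      0 < Q₁ x * y₁ x * y₂ x - y₁ x * (Q₂ x * y₂ x) := by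
    have h1 : ∀ᵐ x ∂(volume.restrict (Icc a b)),
        0 < Q₁ x * y₁ x * y₂ x - y₁ x * (Q₂ x * y₂ x) := by
      filter_upwards [hQ, ae_Icc_mem, ae_Icc_ne a, ae_Icc_ne b] with x hx hxI hxa hxb
      have hxo : x ∈ Ioo a b := ⟨lt_of_le_of_ne hxI.1 hxa.symm, lt_of_le_of_ne hxI.2 hxb⟩
      have := mul_pos (mul_pos (sub_pos.2 hx) (hp₁ x hxo)) (hp₂ x hxo)
      nlinarith
    exact ae_restrict_of_ae_restrict_of_subset Ioc_subset_Icc_self h1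
  rw [intervalIntegral.integral_of_le hab.le] at hle
  have h0 := (integral_eq_zero_iff_of_nonneg_ae (hpos.mono fun x hx => hx.le) hint.1).1
    (le_antisymm hle (integral_nonneg_of_ae (hpos.mono fun x hx => hx.le)))
  have hfalse : ∀ᵐ x ∂(volume.restrict (Ioc a b)), False := by
    filter_upwards [h0, hpos] with x hx hx'
    exact hx'.ne' hx
  rw [Filter.eventually_false_iff_eq_bot, ae_eq_bot, Measure.restrict_eq_zero, Real.volume_Ioc,
    ENNReal.ofReal_eq_zero] at hfalse
  linarith

/-- Sturm's comparison theorem. -/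
theorem sturm_comparison {a b : ℝ} (hab : a < b) {y₁ v₁ y₂ v₂ Q₁ Q₂ : ℝ → ℝ}
    (h₁ : SecondDeriv a b y₁ v₁ (fun x => Q₁ x * y₁ x))
    (h₂ : SecondDeriv a b y₂ v₂ (fun x => Q₂ x * y₂ x))
    (hQ : ∀ᵐ x ∂(volume.restrict (Icc a b)), Q₂ x < Q₁ x) (ha : y₁ a = 0) (hb : y₁ b = 0)
    (hne : ∀ x ∈ Ioo a b, y₁ x ≠ 0) : ∃ x ∈ Ioo a b, y₂ x = 0 := by
  by_contra hcon
  push Not at hcon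
  have hneg : ∀ {y v Q : ℝ → ℝ}, SecondDeriv a b y v (fun x => Q x * y x) →
      SecondDeriv a b (fun x => -1 * y x) (fun x => -1 * v x) (fun x => Q x * (-1 * y x)) :=
    fun h => by
      have := h.const_mul (-1)
      convert this using 2
      ring
  rcases const_sign_of_ne_zero (h₁.continuousOn.mono Ioo_subset_Icc_self) hne with hs₁ | hs₁ <;>
  rcases const_sign_of_ne_zero (h₂.continuousOn.mono Ioo_subset_Icc_self) hcon with hs₂ | hs₂
  · exact sturm_comparison_aux hab h₁ h₂ hQ ha hb hs₁ hs₂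
  · exact sturm_comparison_aux hab h₁ (hneg h₂) hQ ha hb hs₁ fun x hx => by linarith [hs₂ x hx]
  · exact sturm_comparison_aux hab (hneg h₁) h₂ hQ (by simp [ha]) (by simp [hb])
      (fun x hx => by linarith [hs₁ x hx]) hs₂
  · exact sturm_comparison_aux hab (hneg h₁) (hneg h₂) hQ (by simp [ha]) (by simp [hb])
      (fun x hx => by linarith [hs₁ x hx]) fun x hx => by linarith [hs₂ x hx]

/-! ### Zeros of solutions and their dependence on the spectral parameter -/

/-- `y`, with derivative `v`, solves `-y'' + q y = lam y` on `[0,1]`. -/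
def Sol (q : ℝ → ℝ) (lam : ℝ) (y v : ℝ → ℝ) : Prop :=
  SecondDeriv 0 1 y v (fun x => (q x - lam) * y x)

theorem zero_mem_I : (0 : ℝ) ∈ Icc (0 : ℝ) 1 := left_mem_Icc.2 zero_le_one
theorem one_mem_I : (1 : ℝ) ∈ Icc (0 : ℝ) 1 := right_mem_Icc.2 zero_le_one

theorem integrableOn_sub_const {q : ℝ → ℝ} (hq : IntegrableOn q (Icc 0 1)) (lam : ℝ) :
    IntegrableOn (fun x => q x - lam) (Icc 0 1) :=
  hq.sub (integrableOn_const (by simp))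

namespace Sol

variable {q : ℝ → ℝ} {lam : ℝ} {y v : ℝ → ℝ}

theorem deriv_ne_zero (h : Sol q lam y v) (hq : IntegrableOn q (Icc 0 1)) (h0 : v 0 ≠ 0) {z : ℝ}
    (hz : z ∈ Icc (0 : ℝ) 1) (hyz : y z = 0) : v z ≠ 0 := by
  intro hvz
  have hy : ∀ x ∈ Icc (0 : ℝ) 1, y x = 0 := fun x hx =>
    SecondDeriv.eq_zero h hz hyz hvz (integrableOn_sub_const hq lam) (ae_of_all _ fun _ => rfl) hx
  have hd : HasDerivWithinAt y 0 (Icc 0 1) 0 :=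
    (hasDerivWithinAt_const 0 (Icc (0 : ℝ) 1) (0 : ℝ)).congr hy (hy 0 zero_mem_I)
  exact h0 ((uniqueDiffOn_Icc zero_lt_one 0 zero_mem_I).eq_deriv _ (h.deriv 0 zero_mem_I) hd)

/-- By compactness infinitely many zeros would accumulate at a zero, but zeros are simple and
therefore isolated. -/
theorem finite_zeros (h : Sol q lam y v) (hq : IntegrableOn q (Icc 0 1)) (h0 : v 0 ≠ 0) :
    {x ∈ Icc (0 : ℝ) 1 | y x = 0}.Finite := by
  by_contra hinf
  obtain ⟨z, hz, hacc⟩ := Set.Infinite.exists_accPt_of_subset_isCompact hinf isCompact_Icc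
    (sep_subset _ _)
  have hcl : y z = 0 := by
    have hc : IsClosed {x ∈ Icc (0 : ℝ) 1 | y x = 0} :=
      h.continuousOn.preimage_isClosed_of_isClosed isClosed_Icc isClosed_singleton
    exact (hc.closure_subset (mem_closure_iff_clusterPt.2 hacc.clusterPt)).2
  have hne := (h.deriv z hz).eventually_ne (h.deriv_ne_zero hq h0 hz hcl) (c := 0)
  rw [accPt_iff_frequently_nhdsNE] at hacc
  refine hacc ?_
  rw [eventually_nhdsWithin_iff] at hne ⊢
  filter_upwards [hne] with x hx hxz hmem
  exact hx ⟨hmem.1, hxz⟩ hmem.2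

/-- After a zero there is a next zero, if there is any further one. -/
theorem exists_next_zero (h : Sol q lam y v) (hq : IntegrableOn q (Icc 0 1)) (h0 : v 0 ≠ 0) {z w : ℝ}
    (hz : 0 ≤ z) (hzw : z < w) (hw : w ≤ 1) (hyw : y w = 0) :
    ∃ t ∈ Ioc z w, y t = 0 ∧ ∀ x ∈ Ioo z t, y x ≠ 0 := by
  have hfin : {x ∈ Ioc z w | y x = 0}.Finite :=
    (h.finite_zeros hq h0).subset fun x hx => ⟨⟨hz.trans hx.1.1.le, hx.1.2.trans hw⟩, hx.2⟩
  obtain ⟨t, ht, hmin⟩ := hfin.exists_minimal ⟨w, ⟨hzw, le_rfl⟩, hyw⟩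
  refine ⟨t, ht.1, ht.2, fun x hx hx0 => ?_⟩
  exact absurd (hmin ⟨⟨hx.1, hx.2.le.trans ht.1.2⟩, hx0⟩ hx.2.le) (not_le.2 hx.2)

/-- A solution for a larger spectral parameter vanishes strictly more often. -/
theorem encard_zeros_succ_le {mu : ℝ} {y' v' : ℝ → ℝ} (hml : mu < lam) (h : Sol q lam y v)
    (hq : IntegrableOn q (Icc 0 1)) (h' : Sol q mu y' v') (h0' : v' 0 ≠ 0) (hl : y' 0 = 0)
    (hr : y' 1 = 0) :
    {x ∈ Ioo 0 1 | y' x = 0}.encard + 1 ≤ {x ∈ Ioo 0 1 | y x = 0}.encard := by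
  set Z := {x ∈ Ioo (0 : ℝ) 1 | y' x = 0}
  -- The end point `0` supplies the extra one in the count: each `z` in `insert 0 Z` is sent to a
  -- zero of `y` strictly between `z` and the next zero of `y'`.
  have hnot : (0 : ℝ) ∉ Z := fun h => lt_irrefl _ h.1.1
  rw [← encard_insert_of_notMem hnot]
  have hex : ∀ z ∈ insert 0 Z, ∃ w ∈ Ioo z 1, y w = 0 ∧ ∀ x ∈ Ioc z w, y' x ≠ 0 := by
    intro z hz
    have hz' : 0 ≤ z ∧ z < 1 ∧ y' z = 0 := by
      rcases hz with rfl | hz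
      · exact ⟨le_rfl, zero_lt_one, hl⟩
      · exact ⟨hz.1.1.le, hz.1.2, hz.2⟩
    obtain ⟨t, ht, hyt, hne⟩ := h'.exists_next_zero hq h0' hz'.1 hz'.2.1 le_rfl hr
    obtain ⟨w, hw, hw0⟩ := sturm_comparison ht.1 (SecondDeriv.mono h' hz'.1 ht.1.le ht.2)
      (SecondDeriv.mono h hz'.1 ht.1.le ht.2) (ae_of_all _ fun x => by linarith) hz'.2.2 hyt hne
    exact ⟨w, ⟨hw.1, hw.2.trans_le ht.2⟩, hw0, fun x hx => hne x ⟨hx.1, hx.2.trans_lt hw.2⟩⟩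
  choose! ψ hψ hψ0 hψne using hex
  have hnn : ∀ z ∈ insert 0 Z, 0 ≤ z ∧ y' z = 0 := by
    rintro z (rfl | hz)
    exacts [⟨le_rfl, hl⟩, ⟨hz.1.1.le, hz.2⟩]
  refine encard_le_encard_of_injOn (f := ψ)
    (fun z hz => ⟨⟨(hnn z hz).1.trans_lt (hψ z hz).1, (hψ z hz).2⟩, hψ0 z hz⟩) ?_
  have key : ∀ z z', z ∈ insert 0 Z → z' ∈ insert 0 Z → ψ z = ψ z' → ¬ z < z' := by
    intro z z' hz hz' heq hlt
    refine hψne z hz z' ⟨hlt, ?_⟩ (hnn z' hz').2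
    rw [heq]; exact (hψ z' hz').1.le
  exact fun z hz z' hz' heq =>
    le_antisymm (not_lt.1 (key z' z hz' hz heq.symm)) (not_lt.1 (key z z' hz hz' heq))

end Sol

/-- For sufficiently negative spectral parameter, solutions vanishing at `0` have no other zero. -/
theorem exists_no_zeros {q : ℝ → ℝ} (hq : IntegrableOn q (Icc 0 1)) :
    ∃ mu₀ : ℝ, ∀ mu < mu₀, ∀ y v, Sol q mu y v → y 0 = 0 → v 0 ≠ 0 → ∀ x ∈ Ioc (0 : ℝ) 1, y x ≠ 0 := by
  set A := ∫ s in Icc (0 : ℝ) 1, |q s|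
  refine ⟨-A ^ 2, fun mu hmu y v h hy0 hv0 x hx hx0 => ?_⟩
  obtain ⟨t, ht, hyt, hne⟩ := h.exists_next_zero hq hv0 le_rfl hx.1 hx.2 hx0
  have ht1 : t ≤ 1 := ht.2.trans hx.2
  -- The comparison function is `exp G` with `G'' = -|q|` and `G' 0 = 0`, so `|G'| ≤ A`. It is a
  -- positive solution for the coefficient `G'² - |q| ≤ A² + q < q - mu`, whereas comparison would
  -- give it a zero between `0` and `t`.
  obtain ⟨G, g, -, hG, -, hg0⟩ := exists_secondDeriv zero_le_one (r := fun s => -|q s|) hq.abs.neg 0 0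
  have hgA : ∀ x ∈ Icc (0 : ℝ) 1, g x ^ 2 ≤ A ^ 2 := by
    intro x hx
    have := hG.abs_deriv_sub_le hx zero_mem_I
    simp only [hg0, sub_zero, abs_neg, abs_abs] at this
    exact sq_le_sq.2 (this.trans (le_abs_self _))
  have hexp : SecondDeriv 0 1 (fun x => Real.exp (G x)) (fun x => Real.exp (G x) * g x)
      (fun x => (g x ^ 2 - |q x|) * Real.exp (G x)) := by
    have hd : ∀ x ∈ Icc (0 : ℝ) 1, HasDerivWithinAt (fun x => Real.exp (G x))
        (Real.exp (G x) * g x) (Icc 0 1) x := fun x hx => (hG.deriv x hx).exp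
    refine ⟨hd, (ac_of_hasDerivWithinAt zero_le_one hd ?_).fun_mul hG.ac, ?_⟩
    · exact (Real.continuous_exp.comp_continuousOn hG.continuousOn).mul
        (hG.continuousOn_deriv zero_le_one)
    · filter_upwards [hG.ae, hG.ae_self] with x h1 h2
      exact (h2.exp.mul h1).congr_deriv (by ring)
  obtain ⟨w, -, hw0⟩ := sturm_comparison ht.1 (SecondDeriv.mono h le_rfl ht.1.le ht1)
    (hexp.mono le_rfl ht.1.le ht1) (by
      filter_upwards [ae_Icc_mem] with x hx
      have h1 := hgA x ⟨hx.1, hx.2.trans ht1⟩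
      have h2 := neg_abs_le (q x)
      linarith) hy0 hyt hne
  exact (Real.exp_pos _).ne' hw0

namespace Sol

variable {q : ℝ → ℝ} {lam : ℝ} {y v y' v' : ℝ → ℝ}

theorem const_mul (h : Sol q lam y v) (c : ℝ) :
    Sol q lam (fun x => c * y x) (fun x => c * v x) := by
  have := SecondDeriv.const_mul c h
  refine this.congr_ae (ae_of_all _ fun x => ?_)
  ring

theorem congr_ae {q' : ℝ → ℝ} {lam' : ℝ} (h : Sol q lam y v)
    (hqq : ∀ᵐ x ∂(volume.restrict (Icc (0 : ℝ) 1)), (q x - lam) * y x = (q' x - lam') * y x) :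
    Sol q' lam' y v :=
  SecondDeriv.congr_ae h hqq

/-- Solutions vanishing at `0` are proportional. -/
theorem eq_const_mul (h : Sol q lam y v) (h' : Sol q lam y' v') (hq : IntegrableOn q (Icc 0 1))
    (hy : y 0 = 0) (hy' : y' 0 = 0) (hv' : v' 0 ≠ 0) {x : ℝ} (hx : x ∈ Icc (0 : ℝ) 1) :
    y x = v 0 / v' 0 * y' x := by
  have hd := SecondDeriv.sub h (h'.const_mul (v 0 / v' 0))
  have := hd.eq_zero zero_mem_I (by simp [hy, hy']) (by field_simp; ring)
    (integrableOn_sub_const hq lam) (ae_of_all _ fun x => by ring) hx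
  linarith

theorem setOf_zeros_eq (h : Sol q lam y v) (h' : Sol q lam y' v') (hq : IntegrableOn q (Icc 0 1))
    (hy : y 0 = 0) (hy' : y' 0 = 0) (hv : v 0 ≠ 0) (hv' : v' 0 ≠ 0) :
    {x ∈ Ioo (0 : ℝ) 1 | y x = 0} = {x ∈ Ioo (0 : ℝ) 1 | y' x = 0} := by
  ext x
  refine and_congr_right fun hx => ?_
  rw [h.eq_const_mul h' hq hy hy' hv' (Ioo_subset_Icc_self hx)]
  simp [hv, hv']

theorem deriv_zero_ne_zero (h : Sol q lam y v) (hq : IntegrableOn q (Icc 0 1)) (hy : y 0 = 0)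
    (hne : ∃ x ∈ Icc (0 : ℝ) 1, y x ≠ 0) : v 0 ≠ 0 := by
  rintro hv
  obtain ⟨x, hx, hx0⟩ := hne
  exact hx0 (SecondDeriv.eq_zero h zero_mem_I hy hv (integrableOn_sub_const hq lam)
    (ae_of_all _ fun _ => rfl) hx)

/-- Continuous dependence of solutions on the spectral parameter. -/
theorem exists_close (h : Sol q lam y v) (hq : IntegrableOn q (Icc 0 1)) {δ : ℝ} (hδ : 0 < δ) :
    ∃ ρ > 0, ∀ mu, |mu - lam| < ρ → ∀ y' v', Sol q mu y' v' → y' 0 = y 0 → v' 0 = v 0 →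
      ∀ x ∈ Icc (0 : ℝ) 1, |y x - y' x| < δ ∧ |v x - v' x| < δ := by
  set A := (∫ s in Icc (0 : ℝ) 1, |q s|) + |lam| + 1
  set K := 2 * Real.exp (2 * A + 2)
  set Y := ∫ s in Icc (0 : ℝ) 1, |y s|
  have hA0 : 0 ≤ A := by
    have : 0 ≤ ∫ s in Icc (0 : ℝ) 1, |q s| := integral_nonneg fun s => abs_nonneg (q s)
    positivity
  have hK0 : 0 ≤ K := by positivity
  have hY0 : 0 ≤ Y := integral_nonneg fun s => abs_nonneg (y s)
  have hyi : IntegrableOn y (Icc 0 1) := h.continuousOn.integrableOn_Icc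
  -- `D` dominates the Lipschitz constants in `mu` of both the solution and its derivative; the last
  -- summand keeps it positive when `Y = 0`.
  set D := (K + A * K + 1) * Y + 1
  have hD : 0 < D := by positivity
  refine ⟨min 1 (δ / D), by positivity, fun mu hmu y' v' h' h0 hv0 x hx => ?_⟩
  have hmu1 : |mu - lam| < 1 := hmu.trans_le (min_le_left _ _)
  have hmuD : |mu - lam| * D < δ := by
    have := hmu.trans_le (min_le_right _ _)
    rwa [lt_div_iff₀ hD] at this
  set m := |mu - lam|
  have hm0 : 0 ≤ m := abs_nonneg _
  have hd := SecondDeriv.sub h' h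
  have hQi := integrableOn_sub_const hq mu
  have hQA : ∫ s in Icc (0 : ℝ) 1, |q s - mu| ≤ A := by
    have hmuA : |mu| ≤ |lam| + 1 := by
      have := abs_sub_abs_le_abs_sub mu lam; linarith
    calc ∫ s in Icc (0 : ℝ) 1, |q s - mu| ≤ ∫ s in Icc (0 : ℝ) 1, (|q s| + |mu|) := by
          refine integral_mono hQi.abs (hq.abs.add (integrable_const _)) fun s => ?_
          exact abs_sub _ _
      _ = (∫ s in Icc (0 : ℝ) 1, |q s|) + |mu| := by
          rw [integral_add hq.abs (integrable_const _)]; simp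
      _ ≤ A := by simp only [A]; linarith
  have hr : ∀ s, |(q s - mu) * y' s - (q s - lam) * y s| ≤
      |q s - mu| * |y' s - y s| + |(lam - mu) * y s| := fun s => by
    rw [← abs_mul, show (q s - mu) * y' s - (q s - lam) * y s =
      (q s - mu) * (y' s - y s) + (lam - mu) * y s by ring]
    exact abs_add_le _ _
  have hfY : ∫ s in Icc (0 : ℝ) 1, |(lam - mu) * y s| = m * Y := by
    simp only [abs_mul]
    rw [integral_const_mul, abs_sub_comm]
  have hbound : ∀ s ∈ Icc (0 : ℝ) 1, |y' s - y s| ≤ K * (m * Y) := by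
    intro s hs
    rw [← hfY]
    exact hd.apriori zero_mem_I (by simp [h0]) (by simp [hv0]) hQi (hyi.const_mul _)
      (ae_of_all _ hr) hQA hs
  have hvb : |v' x - v x| ≤ A * (K * (m * Y)) + m * Y := by
    have h1 := hd.abs_deriv_sub_le hx zero_mem_I
    rw [hv0, sub_self, sub_zero] at h1
    refine h1.trans ?_
    calc _ ≤ ∫ s in Icc (0 : ℝ) 1, (|q s - mu| * (K * (m * Y)) + |(lam - mu) * y s|) := by
          refine integral_mono_of_nonneg (ae_of_all _ fun s => abs_nonneg _)
            ((hQi.abs.mul_const _).add (hyi.const_mul _).abs) ?_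
          filter_upwards [ae_Icc_mem] with s hs
          refine (hr s).trans ?_
          have := hbound s hs
          gcongr
      _ = (∫ s in Icc (0 : ℝ) 1, |q s - mu|) * (K * (m * Y)) + m * Y := by
          rw [integral_add (hQi.abs.mul_const _) (hyi.const_mul _).abs, integral_mul_const, hfY]
      _ ≤ _ := by gcongr
  have e1 : K * (m * Y) ≤ m * D := by
    have : m * D - K * (m * Y) = m * (A * K * Y + Y + 1) := by simp only [D]; ring
    have : 0 ≤ m * (A * K * Y + Y + 1) := by positivity
    linarith
  have e2 : A * (K * (m * Y)) + m * Y ≤ m * D := by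
    have : m * D - (A * (K * (m * Y)) + m * Y) = m * (K * Y + 1) := by simp only [D]; ring
    have : 0 ≤ m * (K * Y + 1) := by positivity
    linarith
  rw [abs_sub_comm, abs_sub_comm (v x)]
  exact ⟨((hbound x hx).trans e1).trans_lt hmuD, (hvb.trans e2).trans_lt hmuD⟩

end Sol

/-! ### Shooting and the oscillation theorem -/

theorem isEigenfunction_iff {q : ℝ → ℝ} {lam : ℝ} {E : ℝ → ℝ} :
    IsEigenfunction q lam E ↔
      ∃ v, Sol q lam E v ∧ E 0 = 0 ∧ E 1 = 0 ∧ ∃ x ∈ Icc (0 : ℝ) 1, E x ≠ 0 := by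
  constructor
  · rintro ⟨⟨w, hw, heq⟩, h0, h1, hne⟩
    obtain ⟨v, hv⟩ := hasSecondDerivOn_iff.1 hw
    exact ⟨v, hv.congr_ae (by filter_upwards [heq] with x hx; linarith), h0, h1, hne⟩
  · rintro ⟨v, hv, h0, h1, hne⟩
    exact ⟨⟨_, hasSecondDerivOn_iff.2 ⟨v, hv⟩, ae_of_all _ fun x => by ring⟩, h0, h1, hne⟩

theorem exists_sol {q : ℝ → ℝ} (hq : IntegrableOn q (Icc 0 1)) (lam : ℝ) :
    ∃ y v, Sol q lam y v ∧ y 0 = 0 ∧ v 0 = 1 := by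
  obtain ⟨y, v, h, h0, h1⟩ := exists_solution (integrableOn_sub_const hq lam)
    (f := fun _ => 0) (integrable_zero ..) 0 1
  exact ⟨y, v, h.congr_ae (ae_of_all _ fun x => by ring), h0, h1⟩

/-- **Shooting**: below an eigenvalue whose eigenfunctions have more than `k` interior zeros there
is an eigenvalue whose eigenfunctions have exactly `k` interior zeros. -/
theorem exists_sol_encard_zeros_eq {q : ℝ → ℝ} (hq : IntegrableOn q (Icc 0 1)) {lam : ℝ}
    {Y V : ℝ → ℝ → ℝ} (hY : ∀ mu, Sol q mu (Y mu) (V mu)) (hY0 : ∀ mu, Y mu 0 = 0)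
    (hV0 : ∀ mu, V mu 0 = 1) {N : ℝ → ℕ}
    (hN : ∀ mu, {x ∈ Ioo (0 : ℝ) 1 | Y mu x = 0}.encard = N mu) {k : ℕ}
    (hk : k < N lam) : ∃ mu < lam, Y mu 1 = 0 ∧ N mu = k := by
  have hVne : ∀ mu, V mu 0 ≠ 0 := fun mu => by simp [hV0]
  -- Near `s` the zero count can only change if `Y s 1 = 0`, and then it can only go up, by at most
  -- one: a zero may enter through the right end point.
  have hloc : ∀ s, ∃ ρ > 0, ∀ mu, |mu - s| < ρ → N s ≤ N mu ∧ N mu ≤ N s + 1 ∧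
      (Y s 1 ≠ 0 → N mu = N s) := by
    intro s
    have hs := hY s
    have hsimple : ∀ x ∈ Icc (0 : ℝ) 1, Y s x = 0 → V s x ≠ 0 := fun x hx hx0 =>
      hs.deriv_ne_zero hq (hVne s) hx hx0
    by_cases hs1 : Y s 1 = 0
    · obtain ⟨δ, hδ, hst⟩ := exists_stable_zeros_succ zero_lt_one hs.deriv
        (SecondDeriv.continuousOn_deriv hs zero_le_one) (hY0 s) hs1 hsimple
      obtain ⟨ρ, hρ, hcl⟩ := hs.exists_close hq hδ
      refine ⟨ρ, hρ, fun mu hmu => ?_⟩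
      have hc := hcl mu hmu _ _ (hY mu) (by simp [hY0]) (by simp [hV0])
      have := hst _ _ (hY mu).deriv (fun x hx => (hc x hx).1) (fun x hx => (hc x hx).2) (hY0 mu)
      rw [hN, hN] at this
      exact ⟨by exact_mod_cast this.1, by exact_mod_cast this.2, fun h => absurd hs1 h⟩
    · obtain ⟨δ, hδ, hst⟩ := exists_stable_zeros zero_lt_one hs.deriv
        (SecondDeriv.continuousOn_deriv hs zero_le_one) (hY0 s) hsimple
      obtain ⟨ρ, hρ, hcl⟩ := hs.exists_close hq hδ
      refine ⟨ρ, hρ, fun mu hmu => ?_⟩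
      have hc := hcl mu hmu _ _ (hY mu) (by simp [hY0]) (by simp [hV0])
      have := hst _ _ (hY mu).deriv (fun x hx => (hc x hx).1) (fun x hx => (hc x hx).2) (hY0 mu)
        (fun h => absurd h hs1)
      rw [hN, hN] at this
      have : N s = N mu := by exact_mod_cast this
      omega
  obtain ⟨mu₀, hmu₀⟩ := exists_no_zeros hq
  -- The eigenvalue sought is `sSup S`. Points of `S` close below it give `N s ≤ k`, and just above
  -- it the count exceeds `k`. So `N` jumps at `s`, which forces `Y s 1 = 0` and, the jump being at
  -- most one, `N s = k`.
  set S := {mu | mu ≤ lam ∧ N mu ≤ k} with hS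
  have hne : S.Nonempty := by
    refine ⟨min (mu₀ - 1) lam, min_le_right _ _, ?_⟩
    have hlt : min (mu₀ - 1) lam < mu₀ := (min_le_left _ _).trans_lt (by linarith)
    have hz := hmu₀ _ hlt _ _ (hY _) (hY0 _) (hVne _)
    have : {x ∈ Ioo (0 : ℝ) 1 | Y (min (mu₀ - 1) lam) x = 0} = ∅ := by
      ext x
      simp only [mem_ofPred_eq, mem_empty_iff_false, iff_false]
      exact fun hx => hz x (Ioo_subset_Ioc_self hx.1) hx.2
    have hNz := hN (min (mu₀ - 1) lam)
    rw [this, encard_empty] at hNz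
    have : N (min (mu₀ - 1) lam) = 0 := by exact_mod_cast hNz.symm
    omega
  have hbdd : BddAbove S := ⟨lam, fun mu h => h.1⟩
  set s := sSup S
  have hsl : s ≤ lam := csSup_le hne fun mu h => h.1
  obtain ⟨ρ, hρ, hst⟩ := hloc s
  obtain ⟨t, htS, hts⟩ := exists_lt_of_lt_csSup hne (show s - ρ < s by linarith)
  have hts' : t ≤ s := le_csSup hbdd htS
  have hNt := hst t (by rw [abs_lt]; constructor <;> linarith)
  have hNs : N s ≤ k := hNt.1.trans htS.2
  have hslt : s < lam := lt_of_le_of_ne hsl fun h => by rw [h] at hNs; omega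
  set t' := min (s + ρ / 2) lam
  have ht's : s < t' := lt_min (by linarith) hslt
  have ht'l : t' ≤ lam := min_le_right _ _
  have hNt' : k < N t' := by
    by_contra hle
    exact absurd (le_csSup hbdd (show t' ∈ S from ⟨ht'l, not_lt.1 hle⟩)) (not_le.2 ht's)
  have hNst' := hst t' (by
    rw [abs_lt]; constructor <;> linarith [min_le_left (s + ρ / 2) lam])
  refine ⟨s, hslt, ?_, by omega⟩
  by_contra hs1
  have := hNst'.2.2 hs1
  omega

/-- **Sturm's oscillation theorem**: the number of eigenvalues below an eigenvalue equals the number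
of interior zeros of its eigenfunctions. -/
theorem encard_eigenvalues_lt {q : ℝ → ℝ} (hq : IntegrableOn q (Icc 0 1)) {lam : ℝ} {E : ℝ → ℝ}
    (hE : IsEigenfunction q lam E) :
    {mu : ℝ | IsEigenvalue q mu ∧ mu < lam}.encard = {x ∈ Ioo (0 : ℝ) 1 | E x = 0}.encard := by
  choose Y V hY hY0 hV0 using exists_sol hq
  have hVne : ∀ mu, V mu 0 ≠ 0 := fun mu => by simp [hV0]
  have hfin : ∀ mu, ∃ n : ℕ, {x ∈ Ioo (0 : ℝ) 1 | Y mu x = 0}.encard = n := fun mu =>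
    ⟨_, (((hY mu).finite_zeros hq (hVne mu)).subset
      fun x hx => ⟨Ioo_subset_Icc_self hx.1, hx.2⟩).cast_ncard_eq.symm⟩
  choose N hN using hfin
  have heig : ∀ {mu F}, IsEigenfunction q mu F →
      Y mu 1 = 0 ∧ {x ∈ Ioo (0 : ℝ) 1 | F x = 0} = {x ∈ Ioo (0 : ℝ) 1 | Y mu x = 0} := by
    intro mu F hF
    obtain ⟨v, hv, h0, h1, hne⟩ := isEigenfunction_iff.1 hF
    have hv0 := hv.deriv_zero_ne_zero hq h0 hne
    refine ⟨?_, hv.setOf_zeros_eq (hY mu) hq h0 (hY0 mu) hv0 (hVne mu)⟩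
    rw [(hY mu).eq_const_mul hv hq (hY0 mu) h0 hv0 one_mem_I, h1, mul_zero]
  have hmono : ∀ {mu nu}, IsEigenvalue q mu → mu < nu → N mu < N nu := by
    rintro mu nu ⟨F, hF⟩ hlt
    have := (hY nu).encard_zeros_succ_le hlt hq (hY mu) (hVne mu) (hY0 mu) (heig hF).1
    rw [hN, hN] at this
    exact_mod_cast this
  -- Comparison makes `N` strictly increasing on eigenvalues; shooting makes it reach every count
  -- below `N lam`.
  have himg : N '' {mu : ℝ | IsEigenvalue q mu ∧ mu < lam} = ↑(Finset.range (N lam)) := by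
    ext k
    simp only [mem_image, mem_ofPred_eq, Finset.coe_range, mem_Iio]
    constructor
    · rintro ⟨mu, ⟨hmu, hlt⟩, rfl⟩
      exact hmono hmu hlt
    · intro hk
      obtain ⟨mu, hlt, hmu1, hmuk⟩ := exists_sol_encard_zeros_eq hq hY hY0 hV0 hN hk
      refine ⟨mu, ⟨⟨Y mu, isEigenfunction_iff.2 ⟨V mu, hY mu, hY0 mu, hmu1, ?_⟩⟩, hlt⟩, hmuk⟩
      by_contra hcon
      push Not at hcon
      exact (hY mu).deriv_ne_zero hq (hVne mu) one_mem_I hmu1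
        (by
          have hd : HasDerivWithinAt (Y mu) 0 (Icc 0 1) 1 :=
            (hasDerivWithinAt_const 1 (Icc (0 : ℝ) 1) (0 : ℝ)).congr hcon hmu1
          exact (uniqueDiffOn_Icc zero_lt_one 1 one_mem_I).eq_deriv _ ((hY mu).deriv 1 one_mem_I) hd)
  have hinj : InjOn N {mu : ℝ | IsEigenvalue q mu ∧ mu < lam} := by
    intro mu hmu nu hnu heq
    rcases lt_trichotomy mu nu with h | h | h
    · exact absurd heq (hmono hmu.1 h).ne
    · exact h
    · exact absurd heq (hmono hnu.1 h).ne'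
  rw [← hinj.encard_image, himg, encard_coe_eq_coe_finsetCard, Finset.card_range, (heig hE).2, hN]

/-! ### First variation of the `L^p` norm -/

theorem abs_phi {r s : ℝ} (hr : 1 < r) : |phi r s| = |s| ^ (r - 1) := by
  rcases eq_or_ne s 0 with rfl | hs
  · rw [phi, mul_zero, abs_zero, Real.zero_rpow (by linarith)]
  · rw [phi, abs_mul, abs_of_nonneg (Real.rpow_nonneg (abs_nonneg s) _),
      show r - 1 = (r - 2) + 1 by ring, Real.rpow_add_one (abs_ne_zero.2 hs)]

theorem measurable_phi (r : ℝ) : Measurable (phi r) := by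
  unfold phi; fun_prop

/-- The derivative of `t ↦ ∫ |d + t w|^p` at `0`, for `d ∈ L^p` and bounded `w`. -/
theorem hasDerivAt_integral_abs_rpow {p : ℝ} (hp : 1 < p) {μ : Measure ℝ} [IsFiniteMeasure μ]
    {d w : ℝ → ℝ} (hd : MemLp d (ENNReal.ofReal p) μ) (hw : AEStronglyMeasurable w μ) {C : ℝ}
    (hC : ∀ᵐ x ∂μ, |w x| ≤ C) :
    Integrable (fun x => phi p (d x) * w x) μ ∧
    HasDerivAt (fun t => ∫ x, |d x + t * w x| ^ p ∂μ) (p * ∫ x, phi p (d x) * w x ∂μ) 0 := by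
  have hp0 : 0 < p := by linarith
  have hpr : (ENNReal.ofReal p).toReal = p := ENNReal.toReal_ofReal hp0.le
  have hdm := hd.aestronglyMeasurable
  have hdint : Integrable (fun x => |d x| ^ p) μ := by
    have := hd.integrable_norm_rpow'
    rwa [hpr] at this
  have hbint : Integrable (fun x => |(|d x| + (|C| + 1))| ^ p) μ := by
    have := (hd.norm.add (memLp_const (|C| + 1))).integrable_norm_rpow'
    rwa [hpr] at this
  have hphim : AEStronglyMeasurable (fun x => phi p (d x)) μ :=
    ((measurable_phi p).comp_aemeasurable hdm.aemeasurable).aestronglyMeasurable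
  -- The summand `1` in the dominating function makes its base at least `1`, so that the exponent `p
  -- - 1` may be raised to the integrable power `p`.
  have key := hasDerivAt_integral_of_dominated_loc_of_deriv_le (μ := μ) (𝕜 := ℝ)
    (F := fun t x => |d x + t * w x| ^ p) (F' := fun t x => p * (phi p (d x + t * w x) * w x))
    (x₀ := 0) (s := Metric.ball 0 1) (bound := fun x => p * (|(|d x| + (|C| + 1))| ^ p * |C|))
    (Metric.ball_mem_nhds 0 one_pos)
    (Filter.Eventually.of_forall fun t => by
      have : AEMeasurable (fun x => d x + t * w x) μ :=
        hdm.aemeasurable.add (hw.aemeasurable.const_mul t)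
      exact ((by fun_prop : Measurable fun z : ℝ => |z| ^ p).comp_aemeasurable
        this).aestronglyMeasurable)
    (by simpa using hdint)
    (by simpa using (hphim.mul hw).const_mul p)
    (by
      filter_upwards [hC] with x hx t ht
      rw [Metric.mem_ball, dist_zero_right, Real.norm_eq_abs] at ht
      rw [norm_mul, Real.norm_eq_abs, abs_of_pos hp0, norm_mul, Real.norm_eq_abs, Real.norm_eq_abs,
        abs_phi hp]
      have hxC : |w x| ≤ |C| := hx.trans (le_abs_self C)
      have h1 : |d x + t * w x| ≤ |d x| + (|C| + 1) := by
        have h2 : |t * w x| ≤ 1 * |C| := by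
          rw [abs_mul]
          exact mul_le_mul ht.le hxC (abs_nonneg _) zero_le_one
        have := abs_add_le (d x) (t * w x)
        linarith
      have h3 : (1 : ℝ) ≤ |d x| + (|C| + 1) := by
        have := abs_nonneg (d x); have := abs_nonneg C; linarith
      rw [abs_of_nonneg (by linarith : 0 ≤ |d x| + (|C| + 1))]
      gcongr
      calc |d x + t * w x| ^ (p - 1) ≤ (|d x| + (|C| + 1)) ^ (p - 1) :=
            Real.rpow_le_rpow (abs_nonneg _) h1 (by linarith)
        _ ≤ _ := Real.rpow_le_rpow_of_exponent_le h3 (by linarith))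
    ((hbint.mul_const _).const_mul _)
    (ae_of_all _ fun x t _ => by
      have h1 : HasDerivAt (fun t : ℝ => d x + t * w x) (w x) t := by
        simpa using ((hasDerivAt_id t).mul_const (w x)).const_add (d x)
      have h2 := (hasDerivAt_abs_rpow (d x + t * w x) hp).comp t h1
      rw [mul_assoc p, mul_assoc p] at h2
      exact h2)
  simp only [zero_mul, add_zero] at key
  refine ⟨?_, ?_⟩
  · have := key.1.const_mul p⁻¹
    refine this.congr (ae_of_all _ fun x => ?_)
    change p⁻¹ * (p * (phi p (d x) * w x)) = phi p (d x) * w x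
    rw [← mul_assoc, inv_mul_cancel₀ hp0.ne', one_mul]
  · rw [← integral_const_mul]; exact key.2

theorem norm_rpow_eq_integral {p : ℝ} (hp : 1 < p) (f : Potential p) :
    ‖f‖ ^ p = ∫ x in Icc (0 : ℝ) 1, |f x| ^ p := by
  have hp0 : 0 < p := by linarith
  have hpr : (ENNReal.ofReal p).toReal = p := ENNReal.toReal_ofReal hp0.le
  have h0 : 0 ≤ ∫ x in Icc (0 : ℝ) 1, |f x| ^ p := integral_nonneg fun x => by positivity
  rw [Lp.norm_def, MemLp.eLpNorm_eq_integral_rpow_norm (by simpa using hp0) ENNReal.ofReal_ne_top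
    (Lp.memLp f), hpr, ENNReal.toReal_ofReal (by positivity)]
  exact Real.rpow_inv_rpow h0 hp0.ne'

theorem fact_one_le_ofReal {p : ℝ} (hp : 1 < p) : Fact (1 ≤ ENNReal.ofReal p) :=
  ⟨by rw [ENNReal.one_le_ofReal]; exact hp.le⟩

theorem Potential.integrableOn {p : ℝ} (hp : 1 < p) (q : Potential p) :
    IntegrableOn q (Icc (0 : ℝ) 1) :=
  (Lp.memLp q).integrable (fact_one_le_ofReal hp).1

/-- If the distance to `0` of `d + t w` is, up to `O(t²)`, minimal at `t = 0`, then
`∫ φ_p(d) w = 0`. -/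
theorem integral_phi_mul_eq_zero {p : ℝ} (hp : 1 < p) {d w : Potential p} (hd : d ≠ 0) {C : ℝ}
    (hC : ∀ᵐ x ∂(volume.restrict (Icc (0 : ℝ) 1)), |w x| ≤ C) {K ρ : ℝ} (hρ : 0 < ρ)
    (hmin : ∀ t : ℝ, |t| < ρ → ‖d‖ ≤ ‖d + t • w‖ + K * t ^ 2) :
    ∫ x in Icc (0 : ℝ) 1, phi p (d x) * w x = 0 := by
  have := fact_one_le_ofReal hp
  have hp0 : 0 < p := by linarith
  have hdn : 0 < ‖d‖ := norm_pos_iff.2 hd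
  obtain ⟨-, hder⟩ := hasDerivAt_integral_abs_rpow hp (Lp.memLp d) (Lp.aestronglyMeasurable w) hC
  have hN : ∀ t : ℝ, ∫ x in Icc (0 : ℝ) 1, |d x + t * w x| ^ p = ‖d + t • w‖ ^ p := by
    intro t
    rw [norm_rpow_eq_integral hp]
    refine integral_congr_ae ?_
    filter_upwards [Lp.coeFn_add d (t • w), Lp.coeFn_smul t w] with x h1 h2
    rw [h1, Pi.add_apply, h2, Pi.smul_apply, smul_eq_mul]
  simp only [hN] at hder
  -- The comparison function `(‖d‖ - K t²)^p` has derivative `0` at `0`, and subtracting it turns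
  -- the approximate minimum into a genuine local one.
  have hquad : HasDerivAt (fun t : ℝ => ‖d‖ - K * t ^ 2) 0 0 := by
    simpa using ((hasDerivAt_pow 2 (0 : ℝ)).const_mul K).const_sub ‖d‖
  have hquadp := hquad.rpow_const (p := p) (Or.inr hp.le)
  have hG := hder.sub hquadp
  have hloc : IsLocalMin ((fun t : ℝ => ‖d + t • w‖ ^ p) - fun t => (‖d‖ - K * t ^ 2) ^ p) 0 := by
    have hpos : ∀ᶠ t : ℝ in nhds 0, 0 < ‖d‖ - K * t ^ 2 :=
      hquad.continuousAt.eventually (lt_mem_nhds (by simpa using hdn))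
    filter_upwards [hpos, Metric.ball_mem_nhds 0 hρ] with t ht htρ
    rw [Metric.mem_ball, dist_zero_right, Real.norm_eq_abs] at htρ
    have h1 := hmin t htρ
    have h2 : (‖d‖ - K * t ^ 2) ^ p ≤ ‖d + t • w‖ ^ p :=
      Real.rpow_le_rpow ht.le (by linarith) hp0.le
    simpa using h2
  have h0 := hloc.hasDerivAt_eq_zero hG
  simp only [zero_mul, sub_zero] at h0
  exact (mul_eq_zero.1 h0).resolve_left hp0.ne'

/-! ### Nodal data and admissible perturbations -/

theorem IsEigenfunction.congr_ae {q q' : ℝ → ℝ} {lam : ℝ} {E : ℝ → ℝ}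
    (h : IsEigenfunction q lam E) (hq : ∀ᵐ x ∂(volume.restrict (Icc (0 : ℝ) 1)), q x = q' x) :
    IsEigenfunction q' lam E := by
  obtain ⟨v, hv, h0⟩ := isEigenfunction_iff.1 h
  exact isEigenfunction_iff.2 ⟨v, hv.congr_ae (by filter_upwards [hq] with x hx; rw [hx]), h0⟩

theorem isNthEigenpair_iff {q : ℝ → ℝ} (hq : IntegrableOn q (Icc 0 1)) {m : ℕ} {lam : ℝ}
    {E : ℝ → ℝ} : IsNthEigenpair q m lam E ↔
      IsEigenfunction q lam E ∧ {x ∈ Ioo (0 : ℝ) 1 | E x = 0}.encard + 1 = m := by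
  constructor
  · rintro ⟨⟨-, h⟩, hE⟩
    rw [encard_eigenvalues_lt hq hE] at h
    exact ⟨hE, h⟩
  · rintro ⟨hE, h⟩
    rw [← encard_eigenvalues_lt hq hE] at h
    exact ⟨⟨⟨E, hE⟩, h⟩, hE⟩

/-- `E`, with derivative `v`, is an eigenfunction of `q` for `lam` with `m - 1` interior zeros, and
`T` is the `i`-th of them. -/
structure NodalData (q : ℝ → ℝ) (lam : ℝ) (i m : ℕ) (T : ℝ) (E v : ℝ → ℝ) : Prop where
  sol : Sol q lam E v
  left : E 0 = 0
  right : E 1 = 0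
  deriv_left : v 0 ≠ 0
  mem : T ∈ Ioo (0 : ℝ) 1
  node : E T = 0
  card : {x ∈ Ioo (0 : ℝ) 1 | E x = 0}.encard + 1 = m
  card_left : {x ∈ Ioo (0 : ℝ) T | E x = 0}.encard + 1 = i

theorem Sol.exists_ne_zero {q : ℝ → ℝ} {lam : ℝ} {y v : ℝ → ℝ} (h : Sol q lam y v) {z : ℝ}
    (hz : z ∈ Icc (0 : ℝ) 1) (hv : v z ≠ 0) : ∃ x ∈ Icc (0 : ℝ) 1, y x ≠ 0 := by
  by_contra hcon
  push Not at hcon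
  have hd : HasDerivWithinAt y 0 (Icc 0 1) z :=
    (hasDerivWithinAt_const z (Icc (0 : ℝ) 1) (0 : ℝ)).congr hcon (hcon z hz)
  exact hv ((uniqueDiffOn_Icc zero_lt_one z hz).eq_deriv _ (h.deriv z hz) hd)

theorem NodalData.isNode {q : ℝ → ℝ} (hq : IntegrableOn q (Icc 0 1)) {lam : ℝ} {i m : ℕ} {T : ℝ}
    {E v : ℝ → ℝ} (h : NodalData q lam i m T E v) : IsNode q i m T :=
  ⟨lam, E, (isNthEigenpair_iff hq).2 ⟨isEigenfunction_iff.2 ⟨v, h.sol, h.left, h.right,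
    h.sol.exists_ne_zero zero_mem_I h.deriv_left⟩, h.card⟩, h.mem, h.node, h.card_left⟩

/-- `IsNode` comes with an eigenpair of its own. Equal zero counts force equal eigenvalues, since
the larger of two has strictly more zeros; the eigenfunctions are then proportional, and the node
passes to the given `E`. -/
theorem IsNode.exists_nodalData {q : ℝ → ℝ} (hq : IntegrableOn q (Icc 0 1)) {i m : ℕ} {T : ℝ}
    (h : IsNode q i m T) {lam : ℝ} {E : ℝ → ℝ} (hE : IsNthEigenpair q m lam E) :
    ∃ v, NodalData q lam i m T E v := by
  obtain ⟨lam', E', hE', hT, hET, hcard⟩ := h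
  obtain ⟨hEe, hEm⟩ := (isNthEigenpair_iff hq).1 hE
  obtain ⟨hEe', hEm'⟩ := (isNthEigenpair_iff hq).1 hE'
  obtain ⟨v, hv, h0, h1, hne⟩ := isEigenfunction_iff.1 hEe
  obtain ⟨v', hv', h0', h1', hne'⟩ := isEigenfunction_iff.1 hEe'
  have hv0 := hv.deriv_zero_ne_zero hq h0 hne
  have hv0' := hv'.deriv_zero_ne_zero hq h0' hne'
  have hbad : ∀ {n n' : ℕ∞}, n + 1 = (m : ℕ∞) → n' + 1 = (m : ℕ∞) → ¬ n + 1 ≤ n' := by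
    intro n n' h h' hle
    rw [h] at hle
    have h2 : n' + 1 ≤ n' := h' ▸ hle
    have hfin : n' ≠ ⊤ := by
      rintro rfl
      simp at h'
    exact absurd h2 (not_le.2 (ENat.lt_add_one_iff hfin |>.2 le_rfl))
  obtain rfl : lam' = lam := by
    rcases lt_trichotomy lam' lam with hl | hl | hl
    · exact absurd (hv.encard_zeros_succ_le hl hq hv' hv0' h0' h1') (hbad hEm' hEm)
    · exact hl
    · exact absurd (hv'.encard_zeros_succ_le hl hq hv hv0 h0 h1) (hbad hEm hEm')
  have hzero : ∀ x ∈ Icc (0 : ℝ) 1, E x = 0 ↔ E' x = 0 := fun x hx => by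
    rw [hv.eq_const_mul hv' hq h0 h0' hv0' hx]
    simp [hv0, hv0']
  refine ⟨v, hv, h0, h1, hv0, hT, (hzero T (Ioo_subset_Icc_self hT)).2 hET, hEm, ?_⟩
  rw [← hcard]
  congr 2
  ext x
  exact and_congr_right fun hx => hzero x ⟨hx.1.le, hx.2.le.trans hT.2.le⟩

theorem NodalData.congr_ae {q q' : ℝ → ℝ} {lam lam' : ℝ} {i m : ℕ} {T : ℝ} {E v : ℝ → ℝ}
    (h : NodalData q lam i m T E v)
    (hq : ∀ᵐ x ∂(volume.restrict (Icc (0 : ℝ) 1)), q x - lam = q' x - lam') :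
    NodalData q' lam' i m T E v :=
  { h with sol := h.sol.congr_ae (by filter_upwards [hq] with x hx; rw [hx]) }

/-- Small perturbations `E + t η` that vanish at `0`, `T` and `1` have the same nodal counts. -/
theorem NodalData.exists_stable {q : ℝ → ℝ} (hq : IntegrableOn q (Icc 0 1)) {lam : ℝ} {i m : ℕ}
    {T : ℝ} {E v : ℝ → ℝ} (h : NodalData q lam i m T E v) {η ζ r : ℝ → ℝ}
    (hη : SecondDeriv 0 1 η ζ r) (hη0 : η 0 = 0) (hζ0 : ζ 0 = 0) (hηT : η T = 0) (hη1 : η 1 = 0) :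
    ∃ ρ > 0, ∀ t : ℝ, |t| < ρ → ∀ q' : ℝ → ℝ,
      (∀ᵐ x ∂(volume.restrict (Icc (0 : ℝ) 1)),
        (q x - lam) * E x + t * r x = (q' x - lam) * (E x + t * η x)) →
      NodalData q' lam i m T (fun x => E x + t * η x) (fun x => v x + t * ζ x) := by
  have hsol := h.sol
  have hsimple : ∀ x ∈ Icc (0 : ℝ) 1, E x = 0 → v x ≠ 0 := fun x hx hx0 =>
    hsol.deriv_ne_zero hq h.deriv_left hx hx0
  have hT := h.mem
  have hsub : Icc 0 T ⊆ Icc (0 : ℝ) 1 := Icc_subset_Icc_right hT.2.le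
  have hsolT := SecondDeriv.mono hsol le_rfl hT.1.le hT.2.le
  obtain ⟨δ₁, hδ₁, hst₁⟩ := exists_stable_zeros zero_lt_one hsol.deriv
    (SecondDeriv.continuousOn_deriv hsol zero_le_one) h.left hsimple
  obtain ⟨δ₂, hδ₂, hst₂⟩ := exists_stable_zeros hT.1 hsolT.deriv
    (hsolT.continuousOn_deriv hT.1.le) h.left (fun x hx => hsimple x (hsub hx))
  obtain ⟨C₁, hC₁⟩ := isCompact_Icc.exists_bound_of_continuousOn hη.continuousOn
  obtain ⟨C₂, hC₂⟩ := isCompact_Icc.exists_bound_of_continuousOn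
    (hη.continuousOn_deriv zero_le_one)
  set D := |C₁| + |C₂| + 1
  have hD : 0 < D := by positivity
  refine ⟨min δ₁ δ₂ / D, by positivity, fun t ht q' hq' => ?_⟩
  have htD : |t| * D < min δ₁ δ₂ := by rwa [lt_div_iff₀ hD] at ht
  have hsum := SecondDeriv.add hsol (hη.const_mul t)
  have b₁ : ∀ x ∈ Icc (0 : ℝ) 1, |E x - (E x + t * η x)| < min δ₁ δ₂ := fun x hx => by
    rw [sub_add_cancel_left, abs_neg, abs_mul]
    refine lt_of_le_of_lt (mul_le_mul_of_nonneg_left ?_ (abs_nonneg t)) htD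
    have := hC₁ x hx
    rw [Real.norm_eq_abs] at this
    have := le_abs_self C₁
    have := abs_nonneg C₂
    linarith
  have b₂ : ∀ x ∈ Icc (0 : ℝ) 1, |v x - (v x + t * ζ x)| < min δ₁ δ₂ := fun x hx => by
    rw [sub_add_cancel_left, abs_neg, abs_mul]
    refine lt_of_le_of_lt (mul_le_mul_of_nonneg_left ?_ (abs_nonneg t)) htD
    have := hC₂ x hx
    rw [Real.norm_eq_abs] at this
    have := le_abs_self C₂
    have := abs_nonneg C₁
    linarith
  have e₁ := hst₁ _ _ hsum.deriv (fun x hx => (b₁ x hx).trans_le (min_le_left _ _))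
    (fun x hx => (b₂ x hx).trans_le (min_le_left _ _)) (by simp [h.left, hη0])
    (by simp [h.right, hη1])
  have e₂ := hst₂ _ _ (hsum.mono le_rfl hT.1.le hT.2.le).deriv
    (fun x hx => (b₁ x (hsub hx)).trans_le (min_le_right _ _))
    (fun x hx => (b₂ x (hsub hx)).trans_le (min_le_right _ _)) (by simp [h.left, hη0])
    (by simp [h.node, hηT])
  exact
    { sol := hsum.congr_ae hq'
      left := by simp [h.left, hη0]
      right := by simp [h.right, hη1]
      deriv_left := by simpa [hζ0] using h.deriv_left
      mem := hT
      node := by simp [h.node, hηT]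
      card := by rw [← e₁]; exact h.card
      card_left := by rw [← e₂]; exact h.card_left }

/-- Solvability of the linearized equation `η'' = (q - lam) η + w E` with `η = 0` at `0`, `T`, `1`. -/
theorem NodalData.exists_linearized {q : ℝ → ℝ} (hq : IntegrableOn q (Icc 0 1)) {lam : ℝ} {i m : ℕ}
    {T : ℝ} {E v : ℝ → ℝ} (h : NodalData q lam i m T E v) {w : ℝ → ℝ}
    (hw : IntegrableOn w (Icc 0 1)) (h₁ : ∫ x in (0 : ℝ)..T, w x * E x ^ 2 = 0)
    (h₂ : ∫ x in T..1, w x * E x ^ 2 = 0) :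
    ∃ η ζ : ℝ → ℝ, SecondDeriv 0 1 η ζ (fun x => (q x - lam) * η x + w x * E x) ∧
      η 0 = 0 ∧ ζ 0 = 0 ∧ η T = 0 ∧ η 1 = 0 := by
  have hsol := h.sol
  have hT := h.mem
  obtain ⟨η, ζ, hη, hη0, hζ0⟩ := exists_solution (integrableOn_sub_const hq lam)
    (integrableOn_mul_continuousOn hw (SecondDeriv.continuousOn hsol)) 0 0
  have hsimple : ∀ x ∈ Icc (0 : ℝ) 1, E x = 0 → v x ≠ 0 := fun x hx hx0 =>
    hsol.deriv_ne_zero hq h.deriv_left hx hx0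
  -- The Wronskian of `η` and `E` changes by `∫ w E² = 0` over `[c,d]` and vanishes at `c`. At `d`
  -- only `η d * v d` remains, and zeros of `E` are simple.
  have key : ∀ c d, 0 ≤ c → c ≤ d → d ≤ 1 → η c = 0 → E c = 0 → E d = 0 →
      ∫ x in c..d, w x * E x ^ 2 = 0 → η d = 0 := by
    intro c d hc hcd hd hηc hEc hEd hint
    have hW := ((hη.mono hc hcd hd).wronskian (SecondDeriv.mono hsol hc hcd hd) hcd).2
    have e : ∀ x, ((q x - lam) * η x + w x * E x) * E x - η x * ((q x - lam) * E x) =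
        w x * E x ^ 2 := fun x => by ring
    simp only [e, hint, hηc, hEc, hEd, mul_zero, zero_mul, sub_zero, zero_sub] at hW
    have := hsimple d ⟨hc.trans hcd, hd⟩ hEd
    have h0 : η d * v d = 0 := by linarith
    exact (mul_eq_zero.1 h0).resolve_right this
  have hηT := key 0 T le_rfl hT.1.le hT.2.le hη0 h.left h.node h₁
  exact ⟨η, ζ, hη, hη0, hζ0, hηT, key T 1 hT.1.le hT.2.le le_rfl hηT h.node h.right h₂⟩

/-- A bounded direction `w` that is supported away from the zeros of `E` and orthogonal to `E²` on
both sides of the node is tangent to the set of potentials with the given node. -/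
theorem NodalData.exists_isNode_perturb {q : ℝ → ℝ} (hq : IntegrableOn q (Icc 0 1)) {lam : ℝ}
    {i m : ℕ} {T : ℝ} {E v : ℝ → ℝ} (h : NodalData q lam i m T E v) {w : ℝ → ℝ} (hw : Measurable w)
    {C κ : ℝ} (hC : ∀ x, |w x| ≤ C) (hκ : 0 < κ) (hsupp : ∀ x ∈ Icc (0 : ℝ) 1, |E x| < κ → w x = 0)
    (h₁ : ∫ x in (0 : ℝ)..T, w x * E x ^ 2 = 0) (h₂ : ∫ x in T..1, w x * E x ^ 2 = 0) :
    ∃ ρ > 0, ∃ K : ℝ, ∀ t : ℝ, |t| < ρ → ∃ g : ℝ → ℝ,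
      AEStronglyMeasurable g (volume.restrict (Icc (0 : ℝ) 1)) ∧
      (∀ᵐ x ∂(volume.restrict (Icc (0 : ℝ) 1)), |g x| ≤ K * t ^ 2) ∧
      IsNode (fun x => q x + t * w x + g x) i m T := by
  have hC0 : 0 ≤ C := (abs_nonneg _).trans (hC 0)
  have hwi : IntegrableOn w (Icc 0 1) :=
    Integrable.of_bound hw.aestronglyMeasurable C (ae_of_all _ hC)
  obtain ⟨η, ζ, hη, hη0, hζ0, hηT, hη1⟩ := h.exists_linearized hq hwi h₁ h₂
  obtain ⟨ρ, hρ, hst⟩ := h.exists_stable hq hη hη0 hζ0 hηT hη1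
  obtain ⟨D, hD⟩ := isCompact_Icc.exists_bound_of_continuousOn hη.continuousOn
  have hEc := SecondDeriv.continuousOn h.sol
  -- This radius gives `|t η| ≤ κ/2`, so the denominator `E + t η` is at least `κ/2` in absolute
  -- value wherever `|E| ≥ κ`.
  refine ⟨min ρ (κ / (2 * (|D| + 1))), by positivity, C * |D| * (2 / κ), fun t ht => ?_⟩
  have htD : |t| * (2 * (|D| + 1)) < κ := by
    have := ht.trans_le (min_le_right _ _)
    rwa [lt_div_iff₀ (by positivity)] at this
  -- The equation for `E + t η` demands the potential change `t w E / (E + t η)`, which equals `t w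
  -- + g`.
  set g : ℝ → ℝ := fun x => -(t ^ 2 * w x * η x / (E x + t * η x))
  have hηD : ∀ x ∈ Icc (0 : ℝ) 1, |η x| ≤ |D| := fun x hx => (hD x hx).trans (le_abs_self D)
  have hlow : ∀ x ∈ Icc (0 : ℝ) 1, κ ≤ |E x| → κ / 2 ≤ |E x + t * η x| := by
    intro x hx hEx
    have h1 : |t * η x| ≤ |t| * |D| := by
      rw [abs_mul]; exact mul_le_mul_of_nonneg_left (hηD x hx) (abs_nonneg t)
    have h2 := abs_sub_abs_le_abs_add (E x) (t * η x)
    have := abs_nonneg t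
    nlinarith
  have hgm : AEStronglyMeasurable g (volume.restrict (Icc (0 : ℝ) 1)) := by
    have hηm := hη.continuousOn.aemeasurable (μ := volume) measurableSet_Icc
    have hEm := hEc.aemeasurable (μ := volume) measurableSet_Icc
    exact ((((hw.aemeasurable.const_mul _).mul hηm).div
      (hEm.add (hηm.const_mul t))).neg).aestronglyMeasurable
  have hgb : ∀ᵐ x ∂(volume.restrict (Icc (0 : ℝ) 1)), |g x| ≤ C * |D| * (2 / κ) * t ^ 2 := by
    filter_upwards [ae_Icc_mem] with x hx
    rcases lt_or_ge |E x| κ with hlt | hge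
    · simp only [g, hsupp x hx hlt, mul_zero, zero_mul, zero_div, neg_zero, abs_zero]
      positivity
    · simp only [g]
      have h1 := hlow x hx hge
      rw [abs_neg, abs_div, div_le_iff₀ (by linarith), abs_mul, abs_mul, abs_of_nonneg (sq_nonneg t)]
      calc t ^ 2 * |w x| * |η x| ≤ t ^ 2 * C * |D| := 
            mul_le_mul (mul_le_mul_of_nonneg_left (hC x) (sq_nonneg t)) (hηD x hx)
              (abs_nonneg _) (by positivity)
        _ = C * |D| * (2 / κ) * t ^ 2 * (κ / 2) := by field_simp
        _ ≤ _ := by gcongr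
  refine ⟨g, hgm, hgb, NodalData.isNode (lam := lam) ?_
    (hst t (ht.trans_le (min_le_left _ _)) _ ?_)⟩
  · exact (hq.add (hwi.const_mul t)).add (Integrable.of_bound hgm _ hgb)
  · filter_upwards [ae_Icc_mem] with x hx
    rcases lt_or_ge |E x| κ with hlt | hge
    · simp only [g, hsupp x hx hlt]; simp; ring
    · have h1 := hlow x hx hge
      have hne : E x + t * η x ≠ 0 := by
        intro h0; rw [h0, abs_zero] at h1; linarith
      simp only [g]
      field_simp
      ring

/-! ### First-order condition and multipliers -/

/-- The first-order condition at a minimizer, in a direction tangent to the constraint. -/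
theorem IsMinimizer.integral_eq_zero {p : ℝ} (hp : 1 < p) {i m : ℕ} {T : ℝ} {q₀ qhat : Potential p}
    (hmin : IsMinimizer p i m T q₀ qhat) (hne : qhat ≠ q₀) {w : ℝ → ℝ} (hw : Measurable w) {C : ℝ}
    (hC : ∀ x, |w x| ≤ C)
    (htan : ∃ ρ > 0, ∃ K : ℝ, ∀ t : ℝ, |t| < ρ → ∃ g : ℝ → ℝ,
      AEStronglyMeasurable g (volume.restrict (Icc (0 : ℝ) 1)) ∧
      (∀ᵐ x ∂(volume.restrict (Icc (0 : ℝ) 1)), |g x| ≤ K * t ^ 2) ∧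
      IsNode (fun x => qhat x + t * w x + g x) i m T) :
    ∫ x in Icc (0 : ℝ) 1, phi p (qhat x - q₀ x) * w x = 0 := by
  have := fact_one_le_ofReal hp
  obtain ⟨ρ, hρ, K, htan⟩ := htan
  have hwL : MemLp w (ENNReal.ofReal p) (volume.restrict (Icc (0 : ℝ) 1)) :=
    MemLp.of_bound hw.aestronglyMeasurable C (ae_of_all _ hC)
  set W : Potential p := hwL.toLp w
  have hWw := hwL.coeFn_toLp
  have key := integral_phi_mul_eq_zero hp (d := qhat - q₀) (w := W) (sub_ne_zero.2 hne) (C := C)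
    (by filter_upwards [hWw] with x hx; rw [hx]; exact hC x) hρ (K := |K|) fun t ht => by
      obtain ⟨g, hgm, hgb, hnode⟩ := htan t ht
      have hgL : MemLp g (ENNReal.ofReal p) (volume.restrict (Icc (0 : ℝ) 1)) :=
        MemLp.of_bound hgm _ hgb
      set G : Potential p := hgL.toLp g
      have hGg := hgL.coeFn_toLp
      have hGn : ‖G‖ ≤ |K| * t ^ 2 := by
        have h1 := Lp.norm_le_of_ae_bound (f := G) (C := |K| * t ^ 2) (by positivity) (by
          filter_upwards [hGg, hgb] with x hx hx'
          rw [hx, Real.norm_eq_abs]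
          exact hx'.trans (by gcongr; exact le_abs_self K))
        -- The interval has measure `1`, so the uniform `O(t²)` bound on `g` passes to its `L^p`
        -- norm unchanged.
        have h2 : measureUnivNNReal (volume.restrict (Icc (0 : ℝ) 1)) = 1 := by
          simp [measureUnivNNReal]
        rw [h2] at h1
        simpa using h1
      have hnode' : IsNode (qhat + t • W + G : Potential p) i m T := by
        obtain ⟨lam, E, hE, hT, hET, hcard⟩ := hnode
        have hqe : ∀ᵐ x ∂(volume.restrict (Icc (0 : ℝ) 1)),
            qhat x + t * w x + g x = (qhat + t • W + G : Potential p) x := by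
          filter_upwards [Lp.coeFn_add (qhat + t • W) G, Lp.coeFn_add qhat (t • W),
            Lp.coeFn_smul t W, hWw, hGg] with x h1 h2 h3 h4 h5
          rw [h1, Pi.add_apply, h2, Pi.add_apply, h3, Pi.smul_apply, h4, h5, smul_eq_mul]
        have hint := (Potential.integrableOn hp (qhat + t • W + G))
        have hint' : IntegrableOn (fun x => qhat x + t * w x + g x) (Icc 0 1) :=
          hint.congr (by filter_upwards [hqe] with x hx using hx.symm)
        obtain ⟨hEe, hEm⟩ := (isNthEigenpair_iff hint').1 hE
        exact ⟨lam, E, (isNthEigenpair_iff hint).2 ⟨hEe.congr_ae hqe, hEm⟩, hT, hET, hcard⟩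
      calc ‖qhat - q₀‖ ≤ ‖(qhat + t • W + G) - q₀‖ := hmin.minimal _ hnode'
        _ = ‖(qhat - q₀ + t • W) + G‖ := by congr 1; abel
        _ ≤ ‖qhat - q₀ + t • W‖ + ‖G‖ := norm_add_le _ _
        _ ≤ _ := by gcongr
  refine Eq.trans (integral_congr_ae ?_) key
  filter_upwards [hWw, Lp.coeFn_sub qhat q₀] with x h1 h2
  rw [h1, h2, Pi.sub_apply]

theorem measurableSet_le_abs {E : ℝ → ℝ} (hE : ContinuousOn E (Icc (0 : ℝ) 1)) (κ : ℝ) :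
    MeasurableSet {x ∈ Icc (0 : ℝ) 1 | κ ≤ |E x|} :=
  (hE.abs.preimage_isClosed_of_isClosed isClosed_Icc isClosed_Ici).measurableSet

/-- A multiplier rule: if `Φ` annihilates all bounded functions on `S`, supported away from the
zeros of `E`, that are orthogonal to `E²`, then `Φ` is a multiple of `E²` on `S`. -/
theorem exists_multiplier {Φ E : ℝ → ℝ} (hΦ : IntegrableOn Φ (Icc 0 1))
    (hE : ContinuousOn E (Icc (0 : ℝ) 1)) {S : Set ℝ} (hS : MeasurableSet S) (hSI : S ⊆ Icc 0 1)
    (h : ∀ w : ℝ → ℝ, Measurable w → ∀ C κ : ℝ, (∀ x, |w x| ≤ C) → 0 < κ →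
      (∀ x ∈ Icc (0 : ℝ) 1, |E x| < κ → w x = 0) → (∀ x ∉ S, w x = 0) →
      ∫ x in Icc (0 : ℝ) 1, w x * E x ^ 2 = 0 → ∫ x in Icc (0 : ℝ) 1, Φ x * w x = 0) :
    ∃ c : ℝ, ∀ᵐ x ∂(volume.restrict S), E x ≠ 0 → Φ x = c * E x ^ 2 := by
  classical
  set A : ℝ → Set ℝ := fun κ => S ∩ {x ∈ Icc (0 : ℝ) 1 | κ ≤ |E x|}
  have hA : ∀ κ, MeasurableSet (A κ) := fun κ => hS.inter (measurableSet_le_abs hE κ)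
  have hAI : ∀ κ, A κ ⊆ Icc 0 1 := fun κ => inter_subset_left.trans hSI
  have hE2 : IntegrableOn (fun x => E x ^ 2) (Icc 0 1) := (hE.pow 2).integrableOn_Icc
  have main : ∃ c : ℝ, ∀ κ > 0, ∀ᵐ x ∂(volume.restrict (A κ)), Φ x = c * E x ^ 2 := by
    -- One reference set `A κ₀` with nonzero mass fixes `c` independently of `κ`. If there is none,
    -- each `A κ` is null and any constant serves.
    by_cases hD : ∃ κ₀ > 0, ∫ x in A κ₀, E x ^ 2 ≠ 0
    · obtain ⟨κ₀, hκ₀, hD⟩ := hD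
      set D := ∫ x in A κ₀, E x ^ 2
      refine ⟨(∫ x in A κ₀, Φ x) / D, fun κ hκ => ?_⟩
      set c := (∫ x in A κ₀, Φ x) / D
      have hint : IntegrableOn (fun x => Φ x - c * E x ^ 2) (A κ) :=
        (hΦ.sub (hE2.const_mul c)).mono_set (hAI κ)
      have h0 := hint.ae_eq_zero_of_forall_setIntegral_eq_zero fun s hs _ => by
        rw [Measure.restrict_restrict hs]
        set B := s ∩ A κ
        have hB : MeasurableSet B := hs.inter (hA κ)
        have hBI : B ⊆ Icc 0 1 := inter_subset_right.trans (hAI κ)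
        -- Subtracting `α` times the indicator of `A κ₀` makes the indicator of `B` orthogonal to
        -- `E²`; testing with the result gives `∫_B (Φ - c E²) = 0`.
        set α := (∫ x in B, E x ^ 2) / D
        set w : ℝ → ℝ := fun x => B.indicator 1 x - α * (A κ₀).indicator 1 x
        have hprod : ∀ f : ℝ → ℝ, IntegrableOn f (Icc 0 1) →
            ∫ x in Icc (0 : ℝ) 1, f x * w x = (∫ x in B, f x) - α * ∫ x in A κ₀, f x := by
          intro f hf
          have e : ∀ x, f x * w x = B.indicator f x - α * (A κ₀).indicator f x := fun x => by
            simp only [w, indicator_apply, Pi.one_apply]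
            split_ifs <;> ring
          simp only [e]
          rw [integral_sub (hf.indicator hB) ((hf.indicator (hA κ₀)).const_mul α),
            integral_const_mul, setIntegral_indicator hB, setIntegral_indicator (hA κ₀),
            inter_eq_right.2 hBI, inter_eq_right.2 (hAI κ₀)]
        have hw0 : ∀ x, x ∉ A κ → x ∉ A κ₀ → w x = 0 := fun x h1 h2 => by
          simp [w, indicator_of_notMem h2, indicator_of_notMem (fun h => h1 h.2 : x ∉ B)]
        have hann := h w
          ((measurable_one.indicator hB).sub ((measurable_one.indicator (hA κ₀)).const_mul α))
          (1 + |α|) (min κ κ₀) (fun x => by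
            have h1 : |B.indicator (1 : ℝ → ℝ) x| ≤ 1 := by
              simp only [indicator_apply, Pi.one_apply]; split_ifs <;> simp
            have h2 : |(A κ₀).indicator (1 : ℝ → ℝ) x| ≤ 1 := by
              simp only [indicator_apply, Pi.one_apply]; split_ifs <;> simp
            refine (abs_sub _ _).trans ?_
            rw [abs_mul]
            have := mul_le_mul_of_nonneg_left h2 (abs_nonneg α)
            linarith) (lt_min hκ hκ₀)
          (fun x hx hlt => hw0 x (fun hm => absurd hm.2.2 (not_le.2 (hlt.trans_le (min_le_left _ _))))
            fun hm => absurd hm.2.2 (not_le.2 (hlt.trans_le (min_le_right _ _))))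
          (fun x hx => hw0 x (fun hm => hx hm.1) fun hm => hx hm.1) (by
            simp only [mul_comm (w _)]
            rw [hprod _ hE2, div_mul_cancel₀ _ hD, sub_self])
        rw [hprod _ hΦ] at hann
        rw [integral_sub (hΦ.mono_set hBI) ((hE2.mono_set hBI).const_mul c), integral_const_mul]
        have : α * ∫ x in A κ₀, Φ x = c * ∫ x in B, E x ^ 2 := by
          simp only [α, c]; ring
        linarith
      filter_upwards [h0] with x hx
      exact sub_eq_zero.1 hx
    · push Not at hD
      refine ⟨0, fun κ hκ => ?_⟩
      have h0 := (setIntegral_eq_zero_iff_of_nonneg_ae (ae_of_all _ fun x => sq_nonneg (E x))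
        (hE2.mono_set (hAI κ))).1 (hD κ hκ)
      filter_upwards [h0, ae_restrict_mem (hA κ)] with x hx hxA
      have h1 : E x = 0 := by simpa using hx
      have h2 := hxA.2.2
      rw [h1, abs_zero] at h2
      linarith
  obtain ⟨c, hc⟩ := main
  refine ⟨c, ?_⟩
  -- The sets `A (1/(n+1))` exhaust the part of `S` on which `E ≠ 0`.
  have hall : ∀ᵐ x, ∀ n : ℕ, x ∈ A (1 / ((n : ℝ) + 1)) → Φ x = c * E x ^ 2 := by
    rw [ae_all_iff]
    intro n
    have := hc (1 / ((n : ℝ) + 1)) (by positivity)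
    rwa [ae_restrict_iff' (hA _)] at this
  rw [ae_restrict_iff' hS]
  filter_upwards [hall] with x hx hxS hxE
  obtain ⟨n, hn⟩ := exists_nat_one_div_lt (abs_pos.2 hxE)
  exact hx n ⟨hxS, hSI hxS, hn.le⟩

/-- Inversion of `φ_p`. -/
theorem eq_sign_mul_rpow_of_phi_eq {p : ℝ} (hp : 1 < p) {d k e : ℝ} (h : phi p d = k * e ^ 2) :
    d = Real.sign k * |√|k| * e| ^ (2 * conjExp p - 2) := by
  have hp1 : 0 < p - 1 := by linarith
  have hexp : 2 * conjExp p - 2 = 2 * (p - 1)⁻¹ := by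
    rw [conjExp]; field_simp; ring
  have hsq : |√|k| * e| ^ (2 : ℝ) = |d| ^ (p - 1) := by
    rw [← abs_phi hp, h, Real.rpow_two, sq_abs, mul_pow, Real.sq_sqrt (abs_nonneg k), abs_mul,
      abs_of_nonneg (sq_nonneg e)]
  rw [hexp, Real.rpow_mul (abs_nonneg _), hsq, Real.rpow_rpow_inv (abs_nonneg d) hp1.ne']
  rcases eq_or_ne d 0 with rfl | hd
  · simp
  have hpos : 0 < |d| ^ (p - 2) := Real.rpow_pos_of_pos (abs_pos.2 hd) _
  rw [phi] at h
  rcases lt_trichotomy k 0 with hk | rfl | hk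
  · have : d < 0 := by
      by_contra hcon
      have h1 := mul_pos hpos (lt_of_le_of_ne (not_lt.1 hcon) hd.symm)
      nlinarith [sq_nonneg e]
    rw [Real.sign_of_neg hk, abs_of_neg this]; ring
  · rw [zero_mul] at h
    exact absurd h (mul_ne_zero hpos.ne' hd)
  · have : 0 < d := by
      by_contra hcon
      have h1 := mul_neg_of_pos_of_neg hpos (lt_of_le_of_ne (not_lt.1 hcon) hd)
      nlinarith [sq_nonneg e]
    rw [Real.sign_of_pos hk, abs_of_pos this]; ring

theorem NodalData.exists_ne_zero {q : ℝ → ℝ} (hq : IntegrableOn q (Icc 0 1)) {lam : ℝ} {i m : ℕ}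
    {T : ℝ} {E v : ℝ → ℝ} (h : NodalData q lam i m T E v) {c d : ℝ} (hc : 0 ≤ c) (hcd : c < d)
    (hd : d ≤ 1) : ∃ x ∈ Ioo c d, E x ≠ 0 := by
  obtain ⟨x, hx, hx0⟩ := (Ioo_infinite hcd).exists_notMem_finite
    (h.sol.finite_zeros hq h.deriv_left)
  exact ⟨x, hx, fun h0 => hx0 ⟨⟨hc.trans hx.1.le, hx.2.le.trans hd⟩, h0⟩⟩

theorem NodalData.integral_sq_pos {q : ℝ → ℝ} (hq : IntegrableOn q (Icc 0 1)) {lam : ℝ} {i m : ℕ}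
    {T : ℝ} {E v : ℝ → ℝ} (h : NodalData q lam i m T E v) {c d : ℝ} (hc : 0 ≤ c) (hcd : c < d)
    (hd : d ≤ 1) : 0 < ∫ x in c..d, E x ^ 2 := by
  obtain ⟨x, hx, hx0⟩ := h.exists_ne_zero hq hc hcd hd
  refine intervalIntegral.integral_pos hcd
    (((SecondDeriv.continuousOn h.sol).mono (Icc_subset_Icc hc hd)).pow 2)
    (fun x _ => sq_nonneg _) ⟨x, Ioo_subset_Icc_self hx, by positivity⟩

theorem NodalData.ae_ne_zero {q : ℝ → ℝ} (hq : IntegrableOn q (Icc 0 1)) {lam : ℝ} {i m : ℕ}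
    {T : ℝ} {E v : ℝ → ℝ} (h : NodalData q lam i m T E v) :
    ∀ᵐ x, x ∈ Icc (0 : ℝ) 1 → E x ≠ 0 := by
  have := (h.sol.finite_zeros hq h.deriv_left).measure_zero volume
  filter_upwards [measure_eq_zero_iff_ae_notMem.1 this] with x hx hxI h0
  exact hx ⟨hxI, h0⟩

/-- On each side of the node, `φ_p(qhat - q₀)` is a multiple of `E²`, and its mean vanishes. -/
theorem IsMinimizer.exists_side_multipliers {p : ℝ} (hp : 1 < p) {i m : ℕ} {T : ℝ}
    {q₀ qhat : Potential p} (hmin : IsMinimizer p i m T q₀ qhat) (hne : qhat ≠ q₀) {lam : ℝ}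
    {E v : ℝ → ℝ} (h : NodalData qhat lam i m T E v) :
    ∃ cL cR : ℝ,
      (∀ᵐ x ∂(volume.restrict (Icc 0 T)), phi p (qhat x - q₀ x) = cL * E x ^ 2) ∧
      (∀ᵐ x ∂(volume.restrict (Ioc T 1)), phi p (qhat x - q₀ x) = cR * E x ^ 2) ∧
      cL * (∫ x in (0 : ℝ)..T, E x ^ 2) + cR * (∫ x in T..1, E x ^ 2) = 0 := by
  have hq := Potential.integrableOn hp qhat
  have hT := h.mem
  have hEc := SecondDeriv.continuousOn h.sol
  have hdL : MemLp (fun x => qhat x - q₀ x) (ENNReal.ofReal p) (volume.restrict (Icc (0 : ℝ) 1)) :=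
    (Lp.memLp qhat).sub (Lp.memLp q₀)
  have hΦ : IntegrableOn (fun x => phi p (qhat x - q₀ x)) (Icc 0 1) := by
    have := (hasDerivAt_integral_abs_rpow hp hdL (w := fun _ => 1) aestronglyMeasurable_const
      (C := 1) (ae_of_all _ fun _ => by simp)).1
    simp only [mul_one] at this
    exact this
  have hsplit : ∀ f : ℝ → ℝ, IntegrableOn f (Icc 0 1) →
      ∫ x in Icc (0 : ℝ) 1, f x = (∫ x in (0 : ℝ)..T, f x) + ∫ x in T..1, f x := by
    intro f hf
    rw [intervalIntegral.integral_add_adjacent_intervals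
      (intervalIntegrable_of_integrableOn hf zero_mem_I (Ioo_subset_Icc_self hT))
      (intervalIntegrable_of_integrableOn hf (Ioo_subset_Icc_self hT) one_mem_I),
      intervalIntegral.integral_of_le zero_le_one, integral_Icc_eq_integral_Ioc]
  have hL0 : ∀ w : ℝ → ℝ, (∀ x ∉ Ioc T 1, w x = 0) → ∫ x in (0 : ℝ)..T, w x * E x ^ 2 = 0 := by
    intro w hw
    rw [intervalIntegral.integral_of_le hT.1.le]
    exact setIntegral_eq_zero_of_forall_eq_zero fun x hx => by
      rw [hw x fun h => absurd h.1 (not_lt.2 hx.2), zero_mul]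
  have hR0 : ∀ w : ℝ → ℝ, (∀ x ∉ Icc 0 T, w x = 0) → ∫ x in T..1, w x * E x ^ 2 = 0 := by
    intro w hw
    rw [intervalIntegral.integral_of_le hT.2.le]
    exact setIntegral_eq_zero_of_forall_eq_zero fun x hx => by
      rw [hw x fun h => absurd h.2 (not_le.2 hx.1), zero_mul]
  have hwE : ∀ w : ℝ → ℝ, Measurable w → ∀ C : ℝ, (∀ x, |w x| ≤ C) →
      IntegrableOn (fun x => w x * E x ^ 2) (Icc 0 1) := fun w hw C hC =>
    integrableOn_mul_continuousOn
      (Integrable.of_bound hw.aestronglyMeasurable C (ae_of_all _ hC)) (hEc.pow 2)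
  have hae := h.ae_ne_zero hq
  obtain ⟨cL, hcL⟩ := exists_multiplier (S := Icc 0 T) hΦ hEc measurableSet_Icc
    (Icc_subset_Icc_right hT.2.le) fun w hw C κ hC hκ hsupp hS hint => by
      have h2 := hR0 w hS
      rw [hsplit _ (hwE w hw C hC), h2, add_zero] at hint
      exact hmin.integral_eq_zero hp hne hw hC (h.exists_isNode_perturb hq hw hC hκ hsupp hint h2)
  obtain ⟨cR, hcR⟩ := exists_multiplier (S := Ioc T 1) hΦ hEc measurableSet_Ioc
    (Ioc_subset_Icc_self.trans (Icc_subset_Icc_left hT.1.le)) fun w hw C κ hC hκ hsupp hS hint => by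
      have h2 := hL0 w hS
      rw [hsplit _ (hwE w hw C hC), h2, zero_add] at hint
      exact hmin.integral_eq_zero hp hne hw hC (h.exists_isNode_perturb hq hw hC hκ hsupp h2 hint)
  have hcL' : ∀ᵐ x ∂(volume.restrict (Icc 0 T)), phi p (qhat x - q₀ x) = cL * E x ^ 2 := by
    filter_upwards [hcL, ae_restrict_of_ae hae, ae_Icc_mem] with x h1 h2 h3
    exact h1 (h2 ⟨h3.1, h3.2.trans hT.2.le⟩)
  have hcR' : ∀ᵐ x ∂(volume.restrict (Ioc T 1)), phi p (qhat x - q₀ x) = cR * E x ^ 2 := by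
    filter_upwards [hcR, ae_restrict_of_ae hae, ae_restrict_mem measurableSet_Ioc] with x h1 h2 h3
    exact h1 (h2 ⟨hT.1.le.trans h3.1.le, h3.2⟩)
  refine ⟨cL, cR, hcL', hcR', ?_⟩
  -- The direction `w = 1` is exactly tangent, with no correction term: `qhat + t` has the same
  -- eigenfunction for the eigenvalue `lam + t`.
  have hmean := hmin.integral_eq_zero hp hne (w := fun _ => 1) measurable_const (C := 1)
    (fun _ => by simp) ⟨1, one_pos, 0, fun t _ => ⟨fun _ => 0, aestronglyMeasurable_const,
      ae_of_all _ fun x => by simp, NodalData.isNode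
        (q := fun x => qhat x + t * 1 + 0) (lam := lam + t)
        ((hq.add (integrableOn_const (by simp))).add (integrableOn_const (by simp)))
        (h.congr_ae (ae_of_all _ fun x => by ring))⟩⟩
  simp only [mul_one] at hmean
  rw [hsplit _ hΦ] at hmean
  have e1 : ∫ x in (0 : ℝ)..T, phi p (qhat x - q₀ x) = cL * ∫ x in (0 : ℝ)..T, E x ^ 2 := by
    rw [← intervalIntegral.integral_const_mul]
    exact intervalIntegral.integral_congr_ae (ae_uIoc_of_ae_Icc hT.1.le hcL')
  have e2 : ∫ x in T..1, phi p (qhat x - q₀ x) = cR * ∫ x in T..1, E x ^ 2 := by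
    rw [← intervalIntegral.integral_const_mul, intervalIntegral.integral_of_le hT.2.le,
      intervalIntegral.integral_of_le hT.2.le]
    exact integral_congr_ae hcR'
  rw [← e1, ← e2]
  exact hmean

/-! ### Critical equation, nodal counts and conclusion -/

theorem SecondDeriv.congr_self {a b : ℝ} {y v r y' : ℝ → ℝ} (h : SecondDeriv a b y v r)
    (hy : ∀ x ∈ Icc a b, y' x = y x) : SecondDeriv a b y' v r :=
  ⟨fun x hx => (h.deriv x hx).congr hy (hy x hx), h.ac, h.ae⟩

/-- The critical equation on an interval on which `u` is a multiple of the eigenfunction and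
`qhat - q₀` is a signed power of `u`. -/
theorem Sol.critical_equation {q q₀ : ℝ → ℝ} {lam : ℝ} {E v u : ℝ → ℝ} (h : Sol q lam E v)
    {a b s σ r : ℝ} (ha : 0 ≤ a) (hab : a ≤ b) (hb : b ≤ 1) (hu : ∀ x ∈ Icc a b, u x = s * E x)
    (hq : ∀ᵐ x ∂(volume.restrict (Icc a b)), q x - q₀ x = σ * |u x| ^ (r - 2)) :
    ∃ w : ℝ → ℝ, HasSecondDerivOn a b u w ∧
      ∀ᵐ x ∂(volume.restrict (Icc a b)), -w x + q₀ x * u x + σ * phi r (u x) = lam * u x := by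
  have h' := ((SecondDeriv.mono h ha hab hb).const_mul s).congr_self hu
  refine ⟨_, hasSecondDerivOn_iff.2 ⟨_, h'⟩, ?_⟩
  filter_upwards [hq, ae_Icc_mem] with x hx hxI
  have h1 := hu x hxI
  have h2 : σ * phi r (u x) = (q x - q₀ x) * u x := by rw [hx, phi]; ring
  rw [h2, h1]
  ring

/-- The nodes to the right of the `i`-th one. -/
theorem NodalData.card_right {q : ℝ → ℝ} {lam : ℝ} {i m : ℕ} {T : ℝ} {E v : ℝ → ℝ}
    (h : NodalData q lam i m T E v) :
    {x ∈ Ioo (0 : ℝ) T | E x = 0}.encard = ((i - 1 : ℕ) : ℕ∞) ∧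
    {x ∈ Ioo T 1 | E x = 0}.encard = ((m - 1 - i : ℕ) : ℕ∞) := by
  have hT := h.mem
  have hsplit : {x ∈ Ioo (0 : ℝ) 1 | E x = 0} =
      ({x ∈ Ioo (0 : ℝ) T | E x = 0} ∪ {x ∈ Ioo T 1 | E x = 0}) ∪ {T} := by
    ext x
    simp only [mem_union, mem_ofPred_eq, mem_Ioo, mem_singleton_iff]
    constructor
    · rintro ⟨⟨h0, h1⟩, hx⟩
      rcases lt_trichotomy x T with hl | hl | hl
      · exact Or.inl (Or.inl ⟨⟨h0, hl⟩, hx⟩)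
      · exact Or.inr hl
      · exact Or.inl (Or.inr ⟨⟨hl, h1⟩, hx⟩)
    · rintro ((⟨⟨h0, h1⟩, hx⟩ | ⟨⟨h0, h1⟩, hx⟩) | rfl)
      · exact ⟨⟨h0, h1.trans hT.2⟩, hx⟩
      · exact ⟨⟨hT.1.trans h0, h1⟩, hx⟩
      · exact ⟨hT, h.node⟩
  have hd₁ : Disjoint {x ∈ Ioo (0 : ℝ) T | E x = 0} {x ∈ Ioo T 1 | E x = 0} :=
    disjoint_left.2 fun x hx hx' => lt_asymm hx.1.2 hx'.1.1
  have hd₂ : Disjoint ({x ∈ Ioo (0 : ℝ) T | E x = 0} ∪ {x ∈ Ioo T 1 | E x = 0}) {T} := by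
    rw [disjoint_singleton_right]
    rintro (hx | hx)
    exacts [lt_irrefl _ hx.1.2, lt_irrefl _ hx.1.1]
  have hc := h.card
  have hcl := h.card_left
  rw [hsplit, encard_union_eq hd₂, encard_union_eq hd₁, encard_singleton] at hc
  generalize {x ∈ Ioo (0 : ℝ) T | E x = 0}.encard = α at hc hcl ⊢
  generalize {x ∈ Ioo T 1 | E x = 0}.encard = β at hc ⊢
  induction α using ENat.recTopCoe with
  | top => simp at hcl
  | coe α =>
    induction β using ENat.recTopCoe with
    | top => simp at hc
    | coe β =>
      norm_cast at hc hcl ⊢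
      omega

end InverseNodal

theorem mainTheorem2 (p : ℝ) (hp : 1 < p) (i m : ℕ) (hi : 1 ≤ i) (him : i < m)
    (T : ℝ) (hT : T ∈ Ioo (0 : ℝ) 1) (q₀ qhat : InverseNodal.Potential p)
    (hmin : InverseNodal.IsMinimizer p i m T q₀ qhat) (hne : qhat ≠ q₀)
    (lam : ℝ) (E : ℝ → ℝ) (hE : InverseNodal.IsNthEigenpair qhat m lam E) :
    ∃ (c ε : ℝ) (u : ℝ → ℝ), c ≠ 0 ∧ ε = Real.sign c ∧ (ε = 1 ∨ ε = -1) ∧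
      -- the multiplier `c` is the one in the Lagrange equation for `qhat`
      (∀ᵐ x ∂(volume.restrict (Icc (0 : ℝ) 1)),
        ‖qhat - q₀‖ ^ (1 - p) * InverseNodal.phi p (qhat x - q₀ x)
          = c * InverseNodal.stepH E T x * E x ^ 2) ∧
      -- `u` is the piecewise rescaled eigenfunction
      u = InverseNodal.rescaled p ‖qhat - q₀‖ c E T ∧
      -- the critical equation on the two pieces
      (∃ w : ℝ → ℝ, InverseNodal.HasSecondDerivOn 0 T u w ∧
        ∀ᵐ x ∂(volume.restrict (Icc 0 T)),
          -w x + q₀ x * u x + ε * InverseNodal.phi (2 * InverseNodal.conjExp p) (u x)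
            = lam * u x) ∧
      (∃ w : ℝ → ℝ, InverseNodal.HasSecondDerivOn T 1 u w ∧
        ∀ᵐ x ∂(volume.restrict (Icc T 1)),
          -w x + q₀ x * u x - ε * InverseNodal.phi (2 * InverseNodal.conjExp p) (u x)
            = lam * u x) ∧
      -- boundary values and zeros
      u 0 = 0 ∧ u T = 0 ∧ u 1 = 0 ∧
      {x ∈ Ioo 0 T | u x = 0}.encard = ((i - 1 : ℕ) : ℕ∞) ∧
      {x ∈ Ioo T 1 | u x = 0}.encard = ((m - 1 - i : ℕ) : ℕ∞) ∧
      -- recovery of `qhat - q₀`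
      (∀ᵐ x ∂(volume.restrict (Icc 0 T)),
        qhat x - q₀ x = ε * |u x| ^ (2 * InverseNodal.conjExp p - 2)) ∧
      (∀ᵐ x ∂(volume.restrict (Ioc T 1)),
        qhat x - q₀ x = -(ε * |u x| ^ (2 * InverseNodal.conjExp p - 2))) := by
  have hq := InverseNodal.Potential.integrableOn hp qhat
  obtain ⟨v, h⟩ := hmin.node.exists_nodalData hq hE
  obtain ⟨cL, cR, hcL, hcR, hmean⟩ := hmin.exists_side_multipliers hp hne h
  have hvT : v T ≠ 0 := h.sol.deriv_ne_zero hq h.deriv_left (Ioo_subset_Icc_self hT) h.node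
  have hderiv : deriv E T = v T :=
    (InverseNodal.hasDerivAt_of_within (h.sol.deriv T (Ioo_subset_Icc_self hT)) hT).deriv
  set A := ∫ x in T..1, E x ^ 2
  set B := ∫ x in (0 : ℝ)..T, E x ^ 2
  have hA : 0 < A := h.integral_sq_pos hq hT.1.le hT.2 le_rfl
  have hB : 0 < B := h.integral_sq_pos hq le_rfl hT.1 hT.2.le
  set a := InverseNodal.coeffA E T
  set b := InverseNodal.coeffB E T
  have haA : a = A / v T ^ 2 := by
    simp only [a, A, InverseNodal.coeffA, hderiv, div_pow, intervalIntegral.integral_div]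
  have hbB : b = B / v T ^ 2 := by
    simp only [b, B, InverseNodal.coeffB, hderiv, div_pow, intervalIntegral.integral_div]
  have hv2 : 0 < v T ^ 2 := by positivity
  have ha : 0 < a := by rw [haA]; positivity
  have hb : 0 < b := by rw [hbB]; positivity
  have : Fact (1 ≤ ENNReal.ofReal p) := InverseNodal.fact_one_le_ofReal hp
  set R := ‖qhat - q₀‖
  have hR : 0 < R := norm_pos_iff.2 (sub_ne_zero.2 hne)
  have hRp : 0 < R ^ (p - 1) := Real.rpow_pos_of_pos hR _
  have hRR : R ^ (1 - p) * R ^ (p - 1) = 1 := by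
    rw [← Real.rpow_add hR]; simp
  -- `c` is read off from the left side. The right side then agrees by the mean-zero relation, as `a
  -- : b = A : B`.
  set c := R ^ (1 - p) * (cL / a)
  have hcLc : cL = R ^ (p - 1) * a * c := by
    calc cL = (R ^ (1 - p) * R ^ (p - 1)) * (a * (cL / a)) := by
          rw [hRR, mul_div_cancel₀ _ ha.ne', one_mul]
      _ = _ := by simp only [c]; ring
  have hcRc : cR = -(R ^ (p - 1) * b * c) := by
    have h1 : a * B = b * A := by rw [haA, hbB]; ring
    have h2 : (cR + R ^ (p - 1) * b * c) * A = 0 := by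
      rw [hcLc] at hmean
      linear_combination hmean - R ^ (p - 1) * c * h1
    have h3 := (mul_eq_zero.1 h2).resolve_right hA.ne'
    linarith
  have hc : c ≠ 0 := by
    intro h0
    rw [h0, mul_zero] at hcLc hcRc
    refine hne (Lp.ext ?_)
    have hzero : ∀ {x}, InverseNodal.phi p (qhat x - q₀ x) = 0 → qhat x = q₀ x := by
      intro x hx
      rw [← abs_eq_zero, InverseNodal.abs_phi hp,
        Real.rpow_eq_zero (abs_nonneg _) (by linarith), abs_eq_zero] at hx
      linarith
    rw [ae_restrict_iff' measurableSet_Icc] at hcL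
    rw [ae_restrict_iff' measurableSet_Ioc] at hcR
    rw [Filter.EventuallyEq, ae_restrict_iff' measurableSet_Icc]
    filter_upwards [hcL, hcR] with x h1 h2 hx
    rcases le_or_gt x T with hxT | hxT
    · exact hzero (by rw [h1 ⟨hx.1, hxT⟩, hcLc, zero_mul])
    · exact hzero (by rw [h2 ⟨hxT, hx.2⟩, hcRc, neg_zero, zero_mul])
  have hsignL : Real.sign cL = Real.sign c := by
    rw [hcLc]
    rcases lt_or_gt_of_ne hc with h0 | h0
    · rw [Real.sign_of_neg h0, Real.sign_of_neg (mul_neg_of_pos_of_neg (by positivity) h0)]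
    · rw [Real.sign_of_pos h0, Real.sign_of_pos (by positivity)]
  have hsignR : Real.sign cR = -Real.sign c := by
    rw [hcRc, Real.sign_neg]
    rcases lt_or_gt_of_ne hc with h0 | h0
    · rw [Real.sign_of_neg h0, Real.sign_of_neg (mul_neg_of_pos_of_neg (by positivity) h0)]
    · rw [Real.sign_of_pos h0, Real.sign_of_pos (by positivity)]
  set u := InverseNodal.rescaled p R c E T
  have huL : ∀ x ∈ Icc 0 T, u x = √|cL| * E x := fun x hx => by
    simp only [u, InverseNodal.rescaled, if_pos hx.2, hcLc, a]
  have huR' : ∀ x, T < x → u x = √|cR| * E x := fun x hx => by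
    simp only [u, InverseNodal.rescaled, if_neg (not_le.2 hx), hcRc, abs_neg, b]
  -- At `T` the definition of `u` takes the left branch; both branches agree there because `E T =
  -- 0`, so `u` is also a multiple of `E` on the closed right interval.
  have huR : ∀ x ∈ Icc T 1, u x = √|cR| * E x := fun x hx => by
    rcases eq_or_lt_of_le hx.1 with rfl | hlt
    · rw [huL T ⟨hT.1.le, le_rfl⟩, h.node, mul_zero, mul_zero]
    · exact huR' x hlt
  have hsL : √|cL| ≠ 0 := by
    rw [hcLc]; positivity
  have hsR : √|cR| ≠ 0 := by
    rw [hcRc, abs_neg]; positivity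
  have hdL : ∀ᵐ x ∂(volume.restrict (Icc 0 T)),
      qhat x - q₀ x = Real.sign c * |u x| ^ (2 * InverseNodal.conjExp p - 2) := by
    filter_upwards [hcL, ae_restrict_mem measurableSet_Icc] with x hx hxI
    rw [InverseNodal.eq_sign_mul_rpow_of_phi_eq hp hx, hsignL, huL x hxI]
  have hdR : ∀ᵐ x ∂(volume.restrict (Ioc T 1)),
      qhat x - q₀ x = -Real.sign c * |u x| ^ (2 * InverseNodal.conjExp p - 2) := by
    filter_upwards [hcR, ae_restrict_mem measurableSet_Ioc] with x hx hxI
    rw [InverseNodal.eq_sign_mul_rpow_of_phi_eq hp hx, hsignR, huR x (Ioc_subset_Icc_self hxI)]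
  have hcard := h.card_right
  refine ⟨c, Real.sign c, u, hc, rfl, ?_, ?_, rfl, ?_, ?_, ?_, ?_, ?_, ?_, ?_, hdL, ?_⟩
  · rcases Real.sign_apply_eq_of_ne_zero c hc with h0 | h0
    exacts [Or.inr h0, Or.inl h0]
  · rw [ae_restrict_iff' measurableSet_Icc] at hcL ⊢
    rw [ae_restrict_iff' measurableSet_Ioc] at hcR
    filter_upwards [hcL, hcR] with x h1 h2 hx
    rcases le_or_gt x T with hxT | hxT
    · rw [h1 ⟨hx.1, hxT⟩, InverseNodal.stepH, if_pos hxT, hcLc]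
      linear_combination (a * c * E x ^ 2) * hRR
    · rw [h2 ⟨hxT, hx.2⟩, InverseNodal.stepH, if_neg (not_le.2 hxT), hcRc]
      linear_combination (-(b * c * E x ^ 2)) * hRR
  · exact h.sol.critical_equation le_rfl hT.1.le hT.2.le huL hdL
  · obtain ⟨w, hw, hweq⟩ := h.sol.critical_equation (q₀ := q₀) (σ := -Real.sign c)
      (r := 2 * InverseNodal.conjExp p) hT.1.le hT.2.le le_rfl huR
      ((Measure.absolutelyContinuous_of_le
        (Measure.restrict_congr_set Ioc_ae_eq_Icc).ge).ae_le hdR)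
    refine ⟨w, hw, ?_⟩
    filter_upwards [hweq] with x hx
    rw [← hx]; ring
  · rw [huL 0 ⟨le_rfl, hT.1.le⟩, h.left, mul_zero]
  · rw [huL T ⟨hT.1.le, le_rfl⟩, h.node, mul_zero]
  · rw [huR 1 ⟨hT.2.le, le_rfl⟩, h.right, mul_zero]
  · rw [← hcard.1]
    congr 1
    ext x
    exact and_congr_right fun hx => by
      rw [huL x (Ioo_subset_Icc_self hx), mul_eq_zero, or_iff_right hsL]
  · rw [← hcard.2]
    congr 1
    ext x
    exact and_congr_right fun hx => by
      rw [huR x (Ioo_subset_Icc_self hx), mul_eq_zero, or_iff_right hsR]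
  · filter_upwards [hdR] with x hx
    rw [hx]; ring
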